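/- **Theorem (Converse).** Let $d_x,d_u\ge 1$, let $R_x\in\mathbb R^{d_x\times d_x}$ and $R_u\in\mathbb R^{d_u\times d_u}$ be symmetric positive definite, and let $K_0\in\mathbb R^{d_u\times d_x}$ and $r>0$ be given. For a pair $\theta=(A,B)$ consider $$x_{t+1}=Ax_t+Bu_t+w_t,\qquad x_1=0,\qquad w_t\overset{\text{i.i.d.}}{\sim}\mathcal N(0,\sigma^2 I),\qquad c(x,u)=x^\top R_xx+u^\top R_uu .$$ The pair is stabilizable if $\rho(A+BK)<1$ for some $K$. Let $J(\theta,K)=\lim_{T\to\infty}\frac1T\,\mathbb E\sum_{t=1}^T c(x_t,Kx_t)\in[0,\infty]$ be the average cost of the stationary controller $u_t=Kx_t$, let $J_\star(\theta)=\inf_K J(\theta,K)$, and let $\mathrm{Regret}_T=\sum_{t=1}^T c(x_t,u_t)-T J_\star(\theta)$. For stabilizable $\theta$ let $K_\infty(\theta)=-(R_u+B^\top PB)^{-1}B^\top PA$ be the optimal gain, where $P$ is the stabilizing solution of $P=A^\top PA+R_x-A^\top PB(R_u+B^\top PB)^{-1}B^\top PA$. A *scheme* works as follows. In each round $t$ the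 plant appends a finite (possibly empty) string of bits to the uplink transcript; this string may depend on the true system $\theta$ (the plant may know the dynamics), on the states $x_1,\dots,x_t$, on all earlier gains, inputs and messages, and on randomness. Let $\Pi_t$ be the resulting bit string after round $t$'s message. The controller, which has no other information on $\theta$, chooses $K_t$ as a function of $t$, of the bit string $\Pi_t$ and of its own randomness, and the input is $u_t=K_tx_t$. All randomness of the scheme is independent of the noise. The downlink is unconstrained. The scheme transmits at most $b$ bits over a class of systems by time $T$ if, on every system of the class, $\Pi_T$ has length at most $b$ almost surely; let $B(T)$ be the least such $b$ ($B(T)=\infty$ if there is none). Then there is a compact set $\Theta_0$ of stabilizable systems, depending only on $d_x,d_u,R_x,R_u,K_0,r$, with $\rho(A-BK_0)<1$ and $\|K_\infty(A,B)\|_F\le r$ for all $(A,B)\in\Theta_0$, such that for every $\sigma>0$ and $C_1\in\mathbb R$ the following hold. 1. There is a constant $C$, independent of $\alpha$, $T$ and the scheme, such that for every $\alpha\in[1/2,1)$, every $T\ge1$, every class $\Theta\supseteq\Theta_0$ of stabilizable systems (for instance all of them) and every scheme with $\sup_{\theta\in\Theta}\mathbb E_\theta[\mathrm{Regret}_T]\le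 C_1T^\alpha$, $$B(T)\ \ge\ \frac{d_ud_x}{2}(1-\alpha)\log_2T-C .$$ 2. In particular $\Omega(\log T)$ bits are necessary: for every $\alpha\in[1/2,1)$ there are $c>0$ and $T_0$, independent of the scheme, such that $B(T)\ge c\log_2T$ for all $T\ge T_0$, all classes $\Theta$ as above and every scheme with $\sup_{\theta\in\Theta}\mathbb E_\theta[\mathrm{Regret}_T]\le C_1T^\alpha$. In both parts $B(T)$ counts bits over the systems in $\Theta_0$ only, which is at most the number over $\Theta$. -/

import Mathlib

open MeasureTheory ProbabilityTheory Filter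
open scoped ENNReal Matrix

namespace RateLimitedLQR

noncomputable section

/-- A linear system `x⁺ = A x + B u + w` with state dimension `dx` and input dimension `du`:
the pair `(A, B)`. -/
abbrev LinSys (dx du : ℕ) : Type :=
  Matrix (Fin dx) (Fin dx) ℝ × Matrix (Fin dx) (Fin du) ℝ

/-- A gain matrix `K`, acting by `u = K x`. -/
abbrev Gain (dx du : ℕ) : Type := Matrix (Fin du) (Fin dx) ℝ

/-- A real square matrix is Schur stable if its spectral radius (over `ℂ`) is `< 1`. -/
def SchurStable {n : ℕ} (M : Matrix (Fin n) (Fin n) ℝ) : Prop :=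
  spectralRadius ℂ (M.map (algebraMap ℝ ℂ)) < 1

/-- Stabilizability of `(A, B)`: some gain `K` makes `A + B K` Schur stable. -/
def Stabilizable {dx du : ℕ} (θ : LinSys dx du) : Prop :=
  ∃ K : Gain dx du, SchurStable (θ.1 + θ.2 * K)

/-- The Frobenius norm. -/
def frobNorm {m n : ℕ} (K : Matrix (Fin m) (Fin n) ℝ) : ℝ :=
  Real.sqrt (∑ i, ∑ j, K i j ^ 2)

/-- The quadratic stage cost `xᵀ Rx x + uᵀ Ru u`. -/
def stageCost {dx du : ℕ} (Rx : Matrix (Fin dx) (Fin dx) ℝ) (Ru : Matrix (Fin du) (Fin du) ℝ)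
    (x : Fin dx → ℝ) (u : Fin du → ℝ) : ℝ :=
  x ⬝ᵥ (Rx *ᵥ x) + u ⬝ᵥ (Ru *ᵥ u)

/-! ### The Riccati equation and the optimal gain -/

/-- The gain `-(Ru + Bᵀ P B)⁻¹ Bᵀ P A` attached to a matrix `P`. -/
def riccatiGain {dx du : ℕ} (Ru : Matrix (Fin du) (Fin du) ℝ) (θ : LinSys dx du)
    (P : Matrix (Fin dx) (Fin dx) ℝ) : Gain dx du :=
  -((Ru + θ.2ᵀ * P * θ.2)⁻¹ * (θ.2ᵀ * P * θ.1))

/-- `P` is the stabilizing solution of the discrete algebraic Riccati equation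
`P = Aᵀ P A + Rx - Aᵀ P B (Ru + Bᵀ P B)⁻¹ Bᵀ P A`. -/
def IsStabilizingDARESolution {dx du : ℕ} (Rx : Matrix (Fin dx) (Fin dx) ℝ)
    (Ru : Matrix (Fin du) (Fin du) ℝ) (θ : LinSys dx du)
    (P : Matrix (Fin dx) (Fin dx) ℝ) : Prop :=
  P.PosSemidef ∧
  P = θ.1ᵀ * P * θ.1 + Rx
      - θ.1ᵀ * P * θ.2 * (Ru + θ.2ᵀ * P * θ.2)⁻¹ * (θ.2ᵀ * P * θ.1) ∧
  SchurStable (θ.1 + θ.2 * riccatiGain Ru θ P)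

/-- `K` is the optimal stationary gain `K_∞(A, B)`: the gain of the (unique) stabilizing solution
of the Riccati equation. -/
def IsOptimalGain {dx du : ℕ} (Rx : Matrix (Fin dx) (Fin dx) ℝ)
    (Ru : Matrix (Fin du) (Fin du) ℝ) (θ : LinSys dx du) (K : Gain dx du) : Prop :=
  ∃ P, IsStabilizingDARESolution Rx Ru θ P ∧ K = riccatiGain Ru θ P

/-! ### The noise and the optimal stationary cost

Time is indexed from `0` in the code: index `t` is round `t + 1`, and the initial state is `0`. -/

/-- The law of the noise sequence: i.i.d. `N(0, σ² I)`. -/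
def noiseLaw (dx : ℕ) (σ : ℝ) : Measure (ℕ → Fin dx → ℝ) :=
  Measure.infinitePi fun _ : ℕ =>
    Measure.pi fun _ : Fin dx => gaussianReal 0 (Real.toNNReal (σ ^ 2))

/-- State trajectory under the stationary controller `u = K x`, from initial state `0`. -/
def stationaryState {dx du : ℕ} (θ : LinSys dx du) (K : Gain dx du) (w : ℕ → Fin dx → ℝ) :
    ℕ → Fin dx → ℝ
  | 0 => 0
  | t + 1 =>
      θ.1 *ᵥ stationaryState θ K w t + θ.2 *ᵥ (K *ᵥ stationaryState θ K w t) + w t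

/-- Infinite-horizon average expected cost of the stationary controller `K`, with values in
`[0, ∞]`. The expected stage costs are nondecreasing in time, so the averages always converge in
`[0, ∞]` and the `limsup` is their limit. -/
def avgCost {dx du : ℕ} (Rx : Matrix (Fin dx) (Fin dx) ℝ) (Ru : Matrix (Fin du) (Fin du) ℝ)
    (σ : ℝ) (θ : LinSys dx du) (K : Gain dx du) : ℝ≥0∞ :=
  limsup (fun T : ℕ =>
    (∫⁻ w, ENNReal.ofReal (∑ t ∈ Finset.range T,
        stageCost Rx Ru (stationaryState θ K w t) (K *ᵥ stationaryState θ K w t))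
      ∂(noiseLaw dx σ)) / (T : ℝ≥0∞)) atTop

/-- The optimal average cost: the infimum over all stationary controllers. -/
def optCost {dx du : ℕ} (Rx : Matrix (Fin dx) (Fin dx) ℝ) (Ru : Matrix (Fin du) (Fin du) ℝ)
    (σ : ℝ) (θ : LinSys dx du) : ℝ≥0∞ :=
  ⨅ K : Gain dx du, avgCost Rx Ru σ θ K

/-! ### Rate-limited schemes -/

/-- A scheme with a bit-counted uplink and linear policies.

In every round the plant appends a finite, possibly empty, string of bits to the uplink transcript,
and the controller then selects the gain of that round from the transcript, a bit string, and from
its own randomness; the clock is common knowledge.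

The plant's message may depend on the true system (the plant may know the dynamics), on the plant's
own randomness, on all states up to and including the current one, and on the controller's
randomness (the downlink is unconstrained). These determine all past messages, gains and inputs, so
the message may use the whole plant-side past. The dependence on the system is arbitrary. -/
structure UplinkScheme (dx du : ℕ) where
  /-- the plant's randomness -/
  PlantSeed : Type
  /-- the controller's randomness -/
  CtrlSeed : Type
  [instPlant : MeasurableSpace PlantSeed]
  [instCtrl : MeasurableSpace CtrlSeed]
  plantLaw : Measure PlantSeed
  ctrlLaw : Measure CtrlSeed
  [probPlant : IsProbabilityMeasure plantLaw]
  [probCtrl : IsProbabilityMeasure ctrlLaw]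
  /-- the bits appended at time `t`, given the states up to and including time `t` -/
  message : LinSys dx du → (t : ℕ) → PlantSeed × CtrlSeed → (Fin (t + 1) → Fin dx → ℝ) → List Bool
  measurable_message : ∀ θ t l,
    MeasurableSet {p : (PlantSeed × CtrlSeed) × (Fin (t + 1) → Fin dx → ℝ) |
      message θ t p.1 p.2 = l}
  /-- the gain selected at time `t` from the transcript -/
  gain : (t : ℕ) → CtrlSeed → List Bool → Gain dx du
  measurable_gain : ∀ t l i j, Measurable fun s => gain t s l i j

attribute [instance] UplinkScheme.instPlant UplinkScheme.instCtrl
  UplinkScheme.probPlant UplinkScheme.probCtrl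

namespace UplinkScheme

variable {dx du : ℕ}

/-- Sample space of a run: the noise sequence and the two sources of randomness. -/
abbrev Run (S : UplinkScheme dx du) : Type :=
  (ℕ → Fin dx → ℝ) × (S.PlantSeed × S.CtrlSeed)

/-- Law of a run: the noise and the two sources of randomness are independent. -/
def runLaw (S : UplinkScheme dx du) (σ : ℝ) : Measure S.Run :=
  (noiseLaw dx σ).prod (S.plantLaw.prod S.ctrlLaw)

/-- The states up to and including time `t`, together with the transcript on which the gain of
time `t` is based, when the scheme runs on the system `θ`. -/
def history (S : UplinkScheme dx du) (θ : LinSys dx du) (ω : S.Run) :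
    (t : ℕ) → (Fin (t + 1) → Fin dx → ℝ) × List Bool
  | 0 => (fun _ => 0, S.message θ 0 ω.2 fun _ => 0)
  | t + 1 =>
      let past := history S θ ω t
      let x : Fin dx → ℝ := past.1 (Fin.last t)
      let u : Fin du → ℝ := S.gain t ω.2.2 past.2 *ᵥ x
      let states : Fin (t + 1 + 1) → Fin dx → ℝ :=
        Fin.snoc (α := fun _ => Fin dx → ℝ) past.1 (θ.1 *ᵥ x + θ.2 *ᵥ u + ω.1 t)
      (states, past.2 ++ S.message θ (t + 1) ω.2 states)

/-- The state at time `t`. -/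
def state (S : UplinkScheme dx du) (θ : LinSys dx du) (ω : S.Run) (t : ℕ) : Fin dx → ℝ :=
  (S.history θ ω t).1 (Fin.last t)

/-- The uplink transcript available when the gain of time `t` is selected. -/
def transcript (S : UplinkScheme dx du) (θ : LinSys dx du) (ω : S.Run) (t : ℕ) : List Bool :=
  (S.history θ ω t).2

/-- The input at time `t`: the selected gain applied to the current state. -/
def input (S : UplinkScheme dx du) (θ : LinSys dx du) (ω : S.Run) (t : ℕ) : Fin du → ℝ :=
  S.gain t ω.2.2 (S.transcript θ ω t) *ᵥ S.state θ ω t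

/-- Expected total cost over `T` rounds, in `[0, ∞]`. -/
def expectedCost (S : UplinkScheme dx du) (Rx : Matrix (Fin dx) (Fin dx) ℝ)
    (Ru : Matrix (Fin du) (Fin du) ℝ) (σ : ℝ) (θ : LinSys dx du) (T : ℕ) : ℝ≥0∞ :=
  ∫⁻ ω, ENNReal.ofReal
    (∑ t ∈ Finset.range T, stageCost Rx Ru (S.state θ ω t) (S.input θ ω t)) ∂(S.runLaw σ)

/-- Expected regret over `T` rounds against `T` times the optimal average cost. For a stabilizable
system the optimal average cost is finite, so there is no `∞ - ∞`. -/
def expectedRegret (S : UplinkScheme dx du) (Rx : Matrix (Fin dx) (Fin dx) ℝ)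
    (Ru : Matrix (Fin du) (Fin du) ℝ) (σ : ℝ) (θ : LinSys dx du) (T : ℕ) : EReal :=
  (S.expectedCost Rx Ru σ θ T : EReal) - (((T : ℝ≥0∞) * optCost Rx Ru σ θ : ℝ≥0∞) : EReal)

/-- Worst-case expected regret over a class `Θ` of systems. -/
def worstCaseRegret (S : UplinkScheme dx du) (Rx : Matrix (Fin dx) (Fin dx) ℝ)
    (Ru : Matrix (Fin du) (Fin du) ℝ) (σ : ℝ) (Θ : Set (LinSys dx du)) (T : ℕ) : EReal :=
  ⨆ θ ∈ Θ, S.expectedRegret Rx Ru σ θ T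

/-- On every system of the class `Θ`, the transcript of the first `T` rounds almost surely has at
most `b` bits. -/
def TransmitsAtMost (S : UplinkScheme dx du) (σ : ℝ) (Θ : Set (LinSys dx du)) (T b : ℕ) : Prop :=
  ∀ θ ∈ Θ, ∀ᵐ ω ∂(S.runLaw σ), (S.transcript θ ω (T - 1)).length ≤ b

end UplinkScheme

end

end RateLimitedLQR

open RateLimitedLQR

/-! The proof shows that small regret forces the controller to know the optimal gain, and that
knowing it to precision `δ` takes about `du * dx * log₂ (1 / δ)` bits.

Hard systems. Every small gain `K` is the optimal gain of an explicit system with closed loop `½ I`.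
Solving the Lyapunov equation `P = Rx + Kᵀ Ru K + ¼ P` gives `valueMatrix`, and the first-order
condition `Bᵀ P (A + B K) = -Ru K` gives `inputMatrix`. At `K = 0` this is `A = ½ I`, `B = 0`, so
all requirements on the class persist on a small cube of gains (`exists_cube`).

Regret controls deviations. By the Bellman identity the excess cost of a round is at least the
`Ru`-square of `u - K x`. A plain telescoping sum leaves the terminal value, which has no a priori
upper bound; weights decreasing to zero at the horizon remove it (`cost_lower_bound`). Hence the
expected squared deviations over the first `T - 1` rounds sum to `O(T ^ α)` (`sum_deviation_le`).

Deviations force knowledge. The transcript of time `t` fixes the gain that is used at `t + 1` if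
nothing is sent then, whereas the state at `t + 1` contains fresh Gaussian noise. If that gain is
off by more than `δ`, then with probability at least `7 / 8` the resulting input deviation would be
of order `δ`. So in each round bits are sent, or an expected deviation of order `δ ^ 2` is paid, or
the transcript already identifies `K` up to `δ` (`one_le_of_events`).

Counting. All systems run on the same noise and seeds, so for a fixed outcome the gain depends on
the system only through the transcript. Thus at most `2 ^ (b + 1)` members of a `2δ`-separated
family are identified at any time (`sum_measure_closeEvent_le`). For a grid of `m ^ (du * dx)` gains
with `δ` of order `1 / m` and `m` of order `T ^ ((1 - α) / 2)`, the deviations account for only a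
fraction of the rounds. So either `b` is linear in `T`, or `m ^ (du * dx) ≤ 2 ^ (b + 2)`. -/

namespace RateLimitedLQR

/-! ### A family of systems parametrized by their optimal gains -/

section Family

variable {dx du : ℕ} (Rx : Matrix (Fin dx) (Fin dx) ℝ) (Ru : Matrix (Fin du) (Fin du) ℝ)

/-- The value matrix of the system with optimal gain `K` and optimal closed loop `½ I`. -/
noncomputable def valueMatrix (K : Gain dx du) : Matrix (Fin dx) (Fin dx) ℝ :=
  (4 / 3 : ℝ) • (Rx + Kᵀ * Ru * K)

/-- The input matrix of the system with optimal gain `K` and optimal closed loop `½ I`. -/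
noncomputable def inputMatrix (K : Gain dx du) : Matrix (Fin dx) (Fin du) ℝ :=
  (-2 : ℝ) • ((valueMatrix Rx Ru K)⁻¹ * Kᵀ * Ru)

/-- The system with optimal gain `K` and optimal closed loop `½ I`. -/
noncomputable def sysOfGain (K : Gain dx du) : LinSys dx du :=
  ((1 / 2 : ℝ) • 1 - inputMatrix Rx Ru K * K, inputMatrix Rx Ru K)

variable {Rx Ru}

lemma valueMatrix_posDef (hRx : Rx.PosDef) (hRu : Ru.PosDef) (K : Gain dx du) :
    (valueMatrix Rx Ru K).PosDef := by
  refine Matrix.PosDef.smul (hRx.add_posSemidef ?_) (by norm_num)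
  simpa [Matrix.conjTranspose_eq_transpose_of_trivial] using
    hRu.posSemidef.conjTranspose_mul_mul_same K

lemma PosDef_transpose_eq {n : ℕ} {R : Matrix (Fin n) (Fin n) ℝ} (hR : R.PosDef) : Rᵀ = R := by
  simpa [Matrix.conjTranspose_eq_transpose_of_trivial] using hR.isHermitian.eq

lemma closedLoop_sysOfGain (K : Gain dx du) :
    (sysOfGain Rx Ru K).1 + (sysOfGain Rx Ru K).2 * K = (1 / 2 : ℝ) • 1 := by
  simp [sysOfGain]

/-- This is the first-order optimality condition for closed loop `½ I`. The factor `-2` inverts the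
`½`. -/
lemma transpose_inputMatrix_mul (hRx : Rx.PosDef) (hRu : Ru.PosDef) (K : Gain dx du) :
    (inputMatrix Rx Ru K)ᵀ * valueMatrix Rx Ru K = (-2 : ℝ) • (Ru * K) := by
  have hP := valueMatrix_posDef hRx hRu K
  have hu : IsUnit (valueMatrix Rx Ru K).det := (Matrix.isUnit_iff_isUnit_det _).1 hP.isUnit
  simp only [inputMatrix, Matrix.transpose_smul, Matrix.transpose_mul, Matrix.transpose_transpose,
    PosDef_transpose_eq hRu, Matrix.transpose_nonsing_inv, PosDef_transpose_eq hP,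
    Matrix.smul_mul]
  rw [← Matrix.mul_assoc, Matrix.nonsing_inv_mul_cancel_right _ _ hu]

/-- The stationarity condition for `K`. -/
lemma gain_stationary (hRx : Rx.PosDef) (hRu : Ru.PosDef) (K : Gain dx du) :
    (sysOfGain Rx Ru K).2ᵀ * valueMatrix Rx Ru K * (sysOfGain Rx Ru K).1 =
      -((Ru + (sysOfGain Rx Ru K).2ᵀ * valueMatrix Rx Ru K * (sysOfGain Rx Ru K).2) * K) := by
  have h := transpose_inputMatrix_mul hRx hRu K
  simp only [sysOfGain]
  rw [h]
  simp only [Matrix.mul_sub, Matrix.add_mul, Matrix.mul_smul, Matrix.mul_one, Matrix.smul_mul,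
    smul_smul, Matrix.mul_assoc]
  module

lemma inputWeight_posDef (hRx : Rx.PosDef) (hRu : Ru.PosDef) (K : Gain dx du) :
    (Ru + (sysOfGain Rx Ru K).2ᵀ * valueMatrix Rx Ru K * (sysOfGain Rx Ru K).2).PosDef := by
  refine hRu.add_posSemidef ?_
  simpa [Matrix.conjTranspose_eq_transpose_of_trivial] using
    (valueMatrix_posDef hRx hRu K).posSemidef.conjTranspose_mul_mul_same (sysOfGain Rx Ru K).2

lemma riccatiGain_sysOfGain (hRx : Rx.PosDef) (hRu : Ru.PosDef) (K : Gain dx du) :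
    riccatiGain Ru (sysOfGain Rx Ru K) (valueMatrix Rx Ru K) = K := by
  have hu := (Matrix.isUnit_iff_isUnit_det _).1 (inputWeight_posDef hRx hRu K).isUnit
  rw [riccatiGain, gain_stationary hRx hRu K, Matrix.mul_neg, neg_neg, ← Matrix.mul_assoc,
    Matrix.nonsing_inv_mul _ hu, Matrix.one_mul]

lemma schurStable_half (n : ℕ) : SchurStable ((1 / 2 : ℝ) • (1 : Matrix (Fin n) (Fin n) ℝ)) := by
  have h : ((1 / 2 : ℝ) • (1 : Matrix (Fin n) (Fin n) ℝ)).map (algebraMap ℝ ℂ) =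
      algebraMap ℂ (Matrix (Fin n) (Fin n) ℂ) (1 / 2) := by
    ext i j
    by_cases hij : i = j <;> simp [Matrix.algebraMap_matrix_apply, hij]
  rw [SchurStable, h]
  rcases Nat.eq_zero_or_pos n with rfl | hn
  · simp [spectralRadius, spectrum.of_subsingleton]
  · have : Nonempty (Fin n) := ⟨⟨0, hn⟩⟩
    rw [spectralRadius, spectrum.scalar_eq]
    simp only [Set.mem_singleton_iff, iSup_iSup_eq_left]
    norm_cast
    rw [← NNReal.coe_lt_coe]
    norm_num

lemma riccati_sysOfGain (hRx : Rx.PosDef) (hRu : Ru.PosDef) (K : Gain dx du) :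
    IsStabilizingDARESolution Rx Ru (sysOfGain Rx Ru K) (valueMatrix Rx Ru K) := by
  have hP := valueMatrix_posDef hRx hRu K
  refine ⟨hP.posSemidef, ?_, ?_⟩
  · set A := (sysOfGain Rx Ru K).1 with hA
    set B := (sysOfGain Rx Ru K).2 with hB
    set P := valueMatrix Rx Ru K with hPdef
    have hg : -((Ru + Bᵀ * P * B)⁻¹ * (Bᵀ * P * A)) = K := riccatiGain_sysOfGain hRx hRu K
    have hBP : Bᵀ * P = (-2 : ℝ) • (Ru * K) := transpose_inputMatrix_mul hRx hRu K
    have hL : A + B * K = (1 / 2 : ℝ) • 1 := closedLoop_sysOfGain K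
    have hPB : P * B = (-2 : ℝ) • (Kᵀ * Ru) := by
      have := congrArg Matrix.transpose hBP
      simpa [Matrix.transpose_mul, PosDef_transpose_eq hP, PosDef_transpose_eq hRu] using this
    -- Since the Riccati gain is `K`, the right side collapses to `Aᵀ P (A + B K) + Rx = ½ Aᵀ P +
    -- Rx`. Inserting `Aᵀ = ½ I - Kᵀ Bᵀ` yields the Lyapunov equation that defines `P`.
    have e1 : Aᵀ * P * A + Rx - Aᵀ * P * B * (Ru + Bᵀ * P * B)⁻¹ * (Bᵀ * P * A)
        = Aᵀ * (P * (A + B * K)) + Rx := by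
      have : (Ru + Bᵀ * P * B)⁻¹ * (Bᵀ * P * A) = -K := by rw [← hg, neg_neg]
      rw [Matrix.mul_assoc (Aᵀ * P * B), this]
      simp only [Matrix.mul_add, Matrix.mul_neg, Matrix.mul_assoc]
      abel
    have hA' : A = (1 / 2 : ℝ) • 1 - B * K := by rw [← hL]; abel
    have e2 : Aᵀ = (1 / 2 : ℝ) • 1 - Kᵀ * Bᵀ := by rw [hA']; simp [Matrix.transpose_mul]
    rw [e1, hL, e2]
    simp only [Matrix.mul_smul, Matrix.mul_one, Matrix.sub_mul, Matrix.smul_mul, Matrix.one_mul,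
      Matrix.mul_assoc, hBP]
    rw [hPdef, valueMatrix, Matrix.mul_assoc]
    module
  · rw [riccatiGain_sysOfGain hRx hRu K, closedLoop_sysOfGain]
    exact schurStable_half dx

lemma isOptimalGain_sysOfGain (hRx : Rx.PosDef) (hRu : Ru.PosDef) (K : Gain dx du) :
    IsOptimalGain Rx Ru (sysOfGain Rx Ru K) K :=
  ⟨_, riccati_sysOfGain hRx hRu K, (riccatiGain_sysOfGain hRx hRu K).symm⟩

lemma stabilizable_sysOfGain (K : Gain dx du) : Stabilizable (sysOfGain Rx Ru K) :=
  ⟨K, by rw [closedLoop_sysOfGain]; exact schurStable_half dx⟩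

/-- Completion of squares in the Bellman equation. -/
lemma bellman_identity (hRx : Rx.PosDef) (hRu : Ru.PosDef) (K : Gain dx du) (x : Fin dx → ℝ)
    (v : Fin du → ℝ) :
    stageCost Rx Ru x (K *ᵥ x + v) +
      ((1 / 2 : ℝ) • x + inputMatrix Rx Ru K *ᵥ v) ⬝ᵥ
        (valueMatrix Rx Ru K *ᵥ ((1 / 2 : ℝ) • x + inputMatrix Rx Ru K *ᵥ v)) =
    x ⬝ᵥ (valueMatrix Rx Ru K *ᵥ x) + v ⬝ᵥ (Ru *ᵥ v) +
      (inputMatrix Rx Ru K *ᵥ v) ⬝ᵥ (valueMatrix Rx Ru K *ᵥ (inputMatrix Rx Ru K *ᵥ v)) := by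
  set B := inputMatrix Rx Ru K
  have hBP : Bᵀ * valueMatrix Rx Ru K = (-2 : ℝ) • (Ru * K) := transpose_inputMatrix_mul hRx hRu K
  have hPt := PosDef_transpose_eq (valueMatrix_posDef hRx hRu K)
  have hRt := PosDef_transpose_eq hRu
  -- The cross terms of the next value add up to `-2 vᵀ Ru K x` and cancel those of the input cost,
  -- so only squares of `v` remain.
  have c1 : (B *ᵥ v) ⬝ᵥ (valueMatrix Rx Ru K *ᵥ x) = -2 * (v ⬝ᵥ (Ru *ᵥ (K *ᵥ x))) := by
    rw [← Matrix.vecMul_transpose, ← Matrix.dotProduct_mulVec, Matrix.mulVec_mulVec, hBP,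
      Matrix.smul_mulVec, dotProduct_smul, Matrix.mulVec_mulVec, smul_eq_mul]
  have c2 : x ⬝ᵥ (valueMatrix Rx Ru K *ᵥ (B *ᵥ v)) = (B *ᵥ v) ⬝ᵥ (valueMatrix Rx Ru K *ᵥ x) := by
    rw [Matrix.dotProduct_mulVec, ← Matrix.mulVec_transpose, hPt, dotProduct_comm]
  have c3 : (K *ᵥ x) ⬝ᵥ (Ru *ᵥ v) = v ⬝ᵥ (Ru *ᵥ (K *ᵥ x)) := by
    rw [Matrix.dotProduct_mulVec, ← Matrix.mulVec_transpose, hRt, dotProduct_comm]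
  have c4 : x ⬝ᵥ (valueMatrix Rx Ru K *ᵥ x) =
      4 / 3 * (x ⬝ᵥ (Rx *ᵥ x) + (K *ᵥ x) ⬝ᵥ (Ru *ᵥ (K *ᵥ x))) := by
    have : (K *ᵥ x) ⬝ᵥ (Ru *ᵥ (K *ᵥ x)) = x ⬝ᵥ ((Kᵀ * Ru * K) *ᵥ x) := by
      nth_rw 1 [← Matrix.vecMul_transpose]
      rw [← Matrix.dotProduct_mulVec, Matrix.mulVec_mulVec, Matrix.mulVec_mulVec, Matrix.mul_assoc]
    rw [this, valueMatrix, Matrix.smul_mulVec, dotProduct_smul, Matrix.add_mulVec,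
      dotProduct_add, smul_eq_mul]
  simp only [stageCost, Matrix.mulVec_add, dotProduct_add, add_dotProduct, Matrix.mulVec_smul,
    dotProduct_smul, smul_dotProduct, smul_eq_mul, c1, c2, c3]
  linarith [c4]

/-- One-step form of the Bellman identity for the system `sysOfGain Rx Ru K`. -/
lemma bellman_sysOfGain (hRx : Rx.PosDef) (hRu : Ru.PosDef) (K : Gain dx du) (x : Fin dx → ℝ)
    (u : Fin du → ℝ) :
    stageCost Rx Ru x u +
      ((sysOfGain Rx Ru K).1 *ᵥ x + (sysOfGain Rx Ru K).2 *ᵥ u) ⬝ᵥ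
        (valueMatrix Rx Ru K *ᵥ ((sysOfGain Rx Ru K).1 *ᵥ x + (sysOfGain Rx Ru K).2 *ᵥ u)) =
    x ⬝ᵥ (valueMatrix Rx Ru K *ᵥ x) + (u - K *ᵥ x) ⬝ᵥ (Ru *ᵥ (u - K *ᵥ x)) +
      (inputMatrix Rx Ru K *ᵥ (u - K *ᵥ x)) ⬝ᵥ
        (valueMatrix Rx Ru K *ᵥ (inputMatrix Rx Ru K *ᵥ (u - K *ᵥ x))) := by
  have h := bellman_identity hRx hRu K x (u - K *ᵥ x)
  have e : (sysOfGain Rx Ru K).1 *ᵥ x + (sysOfGain Rx Ru K).2 *ᵥ u =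
      (1 / 2 : ℝ) • x + inputMatrix Rx Ru K *ᵥ (u - K *ᵥ x) := by
    simp only [sysOfGain, Matrix.sub_mulVec, Matrix.smul_mulVec, Matrix.one_mulVec,
      Matrix.mulVec_sub, Matrix.mulVec_mulVec]
    abel
  rw [e]
  rw [add_sub_cancel] at h
  exact h

/-! ### Continuity and the compact class -/

lemma continuous_valueMatrix : Continuous (valueMatrix Rx Ru : Gain dx du → _) := by
  unfold valueMatrix
  fun_prop

lemma continuous_inputMatrix (hRx : Rx.PosDef) (hRu : Ru.PosDef) :
    Continuous (inputMatrix Rx Ru : Gain dx du → _) := by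
  have hc := continuous_valueMatrix (Rx := Rx) (Ru := Ru)
  have hinv : Continuous fun K : Gain dx du => (valueMatrix Rx Ru K)⁻¹ := by
    simp only [Matrix.inv_def, Ring.inverse_eq_inv']
    refine Continuous.smul (Continuous.inv₀ hc.matrix_det fun K => ?_) hc.matrix_adjugate
    exact ((Matrix.isUnit_iff_isUnit_det _).1 (valueMatrix_posDef hRx hRu K).isUnit).ne_zero
  unfold inputMatrix
  fun_prop

lemma continuous_sysOfGain (hRx : Rx.PosDef) (hRu : Ru.PosDef) :
    Continuous (sysOfGain Rx Ru : Gain dx du → _) := by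
  have := continuous_inputMatrix hRx hRu
  unfold sysOfGain
  fun_prop

/-- A matrix whose absolute row sums are less than one is Schur stable. -/
lemma schurStable_of_rowSum_lt {n : ℕ} {M : Matrix (Fin n) (Fin n) ℝ}
    (h : ∀ i, ∑ j, |M i j| < 1) : SchurStable M := by
  let _ : NormedRing (Matrix (Fin n) (Fin n) ℂ) := Matrix.linftyOpNormedRing
  let _ : NormedAlgebra ℂ (Matrix (Fin n) (Fin n) ℂ) := Matrix.linftyOpNormedAlgebra
  rcases Nat.eq_zero_or_pos n with rfl | hn
  · rw [SchurStable, spectralRadius, spectrum.of_subsingleton]; simp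
  have : Nonempty (Fin n) := ⟨⟨0, hn⟩⟩
  have : NormOneClass (Matrix (Fin n) (Fin n) ℂ) := Matrix.linfty_opNormOneClass
  have : CompleteSpace (Matrix (Fin n) (Fin n) ℂ) := FiniteDimensional.complete ℂ _
  refine lt_of_le_of_lt (spectrum.spectralRadius_le_nnnorm _) ?_
  norm_cast
  rw [Matrix.linfty_opNNNorm_def, Finset.sup_lt_iff (by norm_num)]
  intro i _
  rw [← NNReal.coe_lt_coe]
  simpa using h i

/-- A positive definite quadratic form dominates a multiple of the squared length. -/
lemma PosDef_exists_lower_bound {n : ℕ} {R : Matrix (Fin n) (Fin n) ℝ} (hR : R.PosDef) :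
    ∃ c : ℝ, 0 < c ∧ ∀ x : Fin n → ℝ, c * (x ⬝ᵥ x) ≤ x ⬝ᵥ (R *ᵥ x) := by
  have hcont : Continuous fun x : Fin n → ℝ => x ⬝ᵥ (R *ᵥ x) := by
    simp only [dotProduct, Matrix.mulVec]; fun_prop
  have hcont' : Continuous fun x : Fin n → ℝ => x ⬝ᵥ x := by
    simp only [dotProduct]; fun_prop
  rcases Nat.eq_zero_or_pos n with rfl | hn
  · exact ⟨1, one_pos, fun x => by simp⟩
  have : Nonempty (Fin n) := ⟨⟨0, hn⟩⟩
  obtain ⟨y, hy, hmin⟩ := (isCompact_sphere (0 : Fin n → ℝ) 1).exists_isMinOn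
    (NormedSpace.sphere_nonempty.2 zero_le_one) hcont.continuousOn
  obtain ⟨z, hz, hmax⟩ := (isCompact_sphere (0 : Fin n → ℝ) 1).exists_isMaxOn
    (NormedSpace.sphere_nonempty.2 zero_le_one) hcont'.continuousOn
  have hne : ∀ w ∈ Metric.sphere (0 : Fin n → ℝ) 1, w ≠ 0 := by
    rintro w hw rfl; simp at hw
  have hpos : 0 < y ⬝ᵥ (R *ᵥ y) := by simpa using hR.dotProduct_mulVec_pos (hne y hy)
  have hzpos : 0 < z ⬝ᵥ z := by
    simpa using (Matrix.PosDef.one (n := Fin n) (R := ℝ)).dotProduct_mulVec_pos (hne z hz)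
  refine ⟨(y ⬝ᵥ (R *ᵥ y)) / (z ⬝ᵥ z), div_pos hpos hzpos, fun x => ?_⟩
  by_cases hx : x = 0
  · simp [hx]
  have hxn : 0 < ‖x‖ := norm_pos_iff.2 hx
  have hw : ‖x‖⁻¹ • x ∈ Metric.sphere (0 : Fin n → ℝ) 1 := by
    simp [norm_smul, hxn.ne']
  have h1 := hmin hw
  have h2 := hmax hw
  simp only [Set.mem_ofPred_eq, Matrix.mulVec_smul, dotProduct_smul, smul_dotProduct,
    smul_eq_mul] at h1 h2
  have h3 : x ⬝ᵥ x ≤ ‖x‖ ^ 2 * (z ⬝ᵥ z) := by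
    have := mul_le_mul_of_nonneg_left h2 (sq_nonneg ‖x‖)
    calc x ⬝ᵥ x = ‖x‖ ^ 2 * (‖x‖⁻¹ * (‖x‖⁻¹ * (x ⬝ᵥ x))) := by field_simp
      _ ≤ _ := this
  have h4 : ‖x‖ ^ 2 * (y ⬝ᵥ (R *ᵥ y)) ≤ x ⬝ᵥ (R *ᵥ x) := by
    have := mul_le_mul_of_nonneg_left h1 (sq_nonneg ‖x‖)
    calc _ ≤ ‖x‖ ^ 2 * (‖x‖⁻¹ * (‖x‖⁻¹ * (x ⬝ᵥ (R *ᵥ x)))) := this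
      _ = _ := by field_simp
  calc (y ⬝ᵥ (R *ᵥ y)) / (z ⬝ᵥ z) * (x ⬝ᵥ x)
      ≤ (y ⬝ᵥ (R *ᵥ y)) / (z ⬝ᵥ z) * (‖x‖ ^ 2 * (z ⬝ᵥ z)) :=
        mul_le_mul_of_nonneg_left h3 (div_pos hpos hzpos).le
    _ = ‖x‖ ^ 2 * (y ⬝ᵥ (R *ᵥ y)) := by field_simp
    _ ≤ _ := h4

lemma quadForm_le_of_entries_le {n : ℕ} {M : Matrix (Fin n) (Fin n) ℝ} {c : ℝ}
    (h : ∀ i j, |M i j| ≤ c) (x : Fin n → ℝ) : x ⬝ᵥ (M *ᵥ x) ≤ n * c * (x ⬝ᵥ x) := by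
  have h1 : ∀ i j, x i * (M i j * x j) ≤ c * ((x i ^ 2 + x j ^ 2) / 2) := fun i j => by
    have ha : x i * (M i j * x j) ≤ |M i j| * (|x i| * |x j|) := by
      rw [← abs_mul, ← abs_mul]; exact (le_abs_self _).trans_eq' (by ring)
    have hb : |x i| * |x j| ≤ (x i ^ 2 + x j ^ 2) / 2 := by
      have := two_mul_le_add_sq |x i| |x j|
      simp only [sq_abs] at this
      linarith
    exact ha.trans (mul_le_mul (h i j) hb (by positivity) ((abs_nonneg _).trans (h i j)))
  calc x ⬝ᵥ (M *ᵥ x) = ∑ i, ∑ j, x i * (M i j * x j) := by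
        simp only [dotProduct, Matrix.mulVec, Finset.mul_sum]
    _ ≤ ∑ i, ∑ j, c * ((x i ^ 2 + x j ^ 2) / 2) :=
        Finset.sum_le_sum fun i _ => Finset.sum_le_sum fun j _ => h1 i j
    _ = n * c * (x ⬝ᵥ x) := by
        simp only [dotProduct, ← Finset.mul_sum, ← Finset.sum_div, Finset.sum_add_distrib,
          Finset.sum_const, Finset.card_univ, Fintype.card_fin, nsmul_eq_mul, ← pow_two]
        ring

/-- On a small cube of gains the systems `sysOfGain Rx Ru K` satisfy all the requirements. -/
lemma exists_cube (hRx : Rx.PosDef) (hRu : Ru.PosDef) (K₀ : Gain dx du) {r : ℝ} (hr : 0 < r) :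
    ∃ ε : ℝ, 0 < ε ∧ ∀ K : Gain dx du, (∀ i j, |K i j| ≤ ε) →
      frobNorm K ≤ r ∧
      SchurStable ((sysOfGain Rx Ru K).1 - (sysOfGain Rx Ru K).2 * K₀) ∧
      ∀ x, x ⬝ᵥ (valueMatrix Rx Ru K *ᵥ x) ≤ 3 * (x ⬝ᵥ (Rx *ᵥ x)) := by
  obtain ⟨c, hc, hcR⟩ := PosDef_exists_lower_bound hRx
  -- Three strict inequalities hold at `K = 0`, where `B = 0` and `A = ½ I`, and hence near it by
  -- continuity.
  have hsys := continuous_sysOfGain (dx := dx) (du := du) hRx hRu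
  have e1 : ∀ᶠ K : Gain dx du in nhds 0, frobNorm K < r := by
    have : Continuous (frobNorm : Gain dx du → ℝ) := by unfold frobNorm; fun_prop
    exact this.continuousAt.eventually_lt continuousAt_const (by simpa [frobNorm] using hr)
  have e2 : ∀ᶠ K : Gain dx du in nhds 0, ∀ i,
      ∑ j, |((sysOfGain Rx Ru K).1 - (sysOfGain Rx Ru K).2 * K₀) i j| < 1 := by
    rw [eventually_all]
    intro i
    have : Continuous fun K : Gain dx du =>
        ∑ j, |((sysOfGain Rx Ru K).1 - (sysOfGain Rx Ru K).2 * K₀) i j| := by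
      have hA := hsys.fst
      have hB := hsys.snd
      fun_prop
    refine this.continuousAt.eventually_lt continuousAt_const ?_
    simp [sysOfGain, inputMatrix, Matrix.one_apply, apply_ite abs]
    norm_num
  -- This bound gives `Kᵀ Ru K ≤ Rx` as quadratic forms, so the value matrix is at most `(8 / 3)
  -- Rx`.
  have e3 : ∀ᶠ K : Gain dx du in nhds 0, ∀ i j, |(Kᵀ * Ru * K) i j| < c / (dx + 1) := by
    simp only [eventually_all]
    intro i j
    have : Continuous fun K : Gain dx du => |(Kᵀ * Ru * K) i j| := by fun_prop
    exact this.continuousAt.eventually_lt continuousAt_const (by simp; positivity)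
  have e := (e1.and (e2.and e3))
  obtain ⟨ε, hε, hball⟩ := Metric.eventually_nhds_iff.1
    (show ∀ᶠ K : Fin du → Fin dx → ℝ in nhds 0, _ from e)
  refine ⟨ε / 2, by positivity, fun K hK => ?_⟩
  have hd : dist (α := Fin du → Fin dx → ℝ) K 0 < ε := by
    refine lt_of_le_of_lt ((dist_pi_le_iff (by positivity)).2 fun i =>
      (dist_pi_le_iff (by positivity)).2 fun j => ?_) (half_lt_self hε)
    simpa [Real.dist_eq] using hK i j
  obtain ⟨h1, h2, h3⟩ := hball hd
  refine ⟨h1.le, schurStable_of_rowSum_lt h2, fun x => ?_⟩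
  have h4 := quadForm_le_of_entries_le (fun i j => (h3 i j).le) x
  have hxx : 0 ≤ x ⬝ᵥ x := by simpa using dotProduct_star_self_nonneg x
  have h5 : (dx : ℝ) * (c / (dx + 1)) * (x ⬝ᵥ x) ≤ c * (x ⬝ᵥ x) := by
    refine mul_le_mul_of_nonneg_right ?_ hxx
    rw [mul_div_assoc', div_le_iff₀ (by positivity)]
    nlinarith
  have h6 := hcR x
  rw [valueMatrix, Matrix.smul_mulVec, dotProduct_smul, Matrix.add_mulVec, dotProduct_add,
    smul_eq_mul]
  nlinarith

/-- The systems whose optimal gain has entries at most `ε` in absolute value. -/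
def cubeClass (Rx : Matrix (Fin dx) (Fin dx) ℝ) (Ru : Matrix (Fin du) (Fin du) ℝ) (ε : ℝ) :
    Set (LinSys dx du) :=
  sysOfGain Rx Ru '' {K | ∀ i j, |K i j| ≤ ε}

lemma isCompact_cubeClass (hRx : Rx.PosDef) (hRu : Ru.PosDef) (ε : ℝ) :
    IsCompact (cubeClass (dx := dx) (du := du) Rx Ru ε) := by
  refine IsCompact.image ?_ (continuous_sysOfGain hRx hRu)
  have : IsCompact (Set.univ.pi fun _ : Fin du => Set.univ.pi fun _ : Fin dx => Set.Icc (-ε) ε) :=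
    isCompact_univ_pi fun _ => isCompact_univ_pi fun _ => isCompact_Icc
  refine this.of_isClosed_subset ?_ ?_
  · simp only [Set.ofPred_forall]
    refine isClosed_iInter fun i => isClosed_iInter fun j => isClosed_le ?_ continuous_const
    exact ((continuous_apply j).comp (continuous_apply i)).abs
  · exact fun K hK i _ j _ => abs_le.1 (hK i j)

end Family

/-! ### Resampling one coordinate of a product measure -/

lemma measurable_update_pair {ι : Type*} [DecidableEq ι] {X : ι → Type*}
    [∀ i, MeasurableSpace (X i)] (i : ι) :
    Measurable fun p : (∀ i, X i) × X i => Function.update p.1 i p.2 := by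
  refine measurable_pi_iff.2 fun j => ?_
  by_cases hj : j = i
  · subst hj; simpa using measurable_snd
  · simp only [Function.update_of_ne hj]
    exact (measurable_pi_apply j).comp measurable_fst

lemma map_update_infinitePi {ι : Type*} [DecidableEq ι] {X : ι → Type*}
    [∀ i, MeasurableSpace (X i)] (μ : ∀ i, Measure (X i)) [∀ i, IsProbabilityMeasure (μ i)]
    (i : ι) :
    ((Measure.infinitePi μ).prod (μ i)).map (fun p => Function.update p.1 i p.2) =
      Measure.infinitePi μ := by
  refine Measure.eq_infinitePi μ fun s t ht => ?_
  have hm := measurable_update_pair (X := X) i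
  rw [Measure.map_apply hm (MeasurableSet.pi s.countable_toSet fun j _ => ht j)]
  by_cases hi : i ∈ s
  · have : (fun p : (∀ i, X i) × X i => Function.update p.1 i p.2) ⁻¹' (Set.pi s t) =
        (Set.pi (s.erase i : Finset ι) t) ×ˢ t i := by
      ext p
      simp only [Set.mem_preimage, Set.mem_pi, Set.mem_prod, Finset.coe_erase, Set.mem_sdiff,
        Finset.mem_coe, Set.mem_singleton_iff]
      constructor
      · intro h
        refine ⟨fun j hj => ?_, by simpa using h i hi⟩
        simpa [Function.update_of_ne hj.2] using h j hj.1
      · rintro ⟨h1, h2⟩ j hj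
        by_cases hji : j = i
        · subst hji; simpa using h2
        · simpa [Function.update_of_ne hji] using h1 j ⟨hj, hji⟩
    rw [this, Measure.prod_prod, Measure.infinitePi_pi _ fun j _ => ht j,
      Finset.prod_erase_mul _ _ hi]
  · have : (fun p : (∀ i, X i) × X i => Function.update p.1 i p.2) ⁻¹' (Set.pi s t) =
        (Set.pi s t) ×ˢ Set.univ := by
      ext p
      simp only [Set.mem_preimage, Set.mem_pi, Set.mem_prod, Finset.mem_coe, Set.mem_univ, and_true]
      refine forall₂_congr fun j hj => ?_
      have hne : j ≠ i := fun h => hi (by rwa [← h])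
      rw [Function.update_of_ne hne]
    rw [this, Measure.prod_prod, Measure.infinitePi_pi _ fun j _ => ht j, measure_univ, mul_one]

/-- This plays the role of conditioning on all other coordinates: whatever does not depend on
coordinate `i` is frozen in the inner integral. -/
lemma lintegral_infinitePi_update {ι : Type*} [DecidableEq ι] {X : ι → Type*}
    [∀ i, MeasurableSpace (X i)] (μ : ∀ i, Measure (X i)) [∀ i, IsProbabilityMeasure (μ i)]
    (i : ι) {f : (∀ i, X i) → ℝ≥0∞} (hf : Measurable f) :
    ∫⁻ w, f w ∂(Measure.infinitePi μ) =
      ∫⁻ w, ∫⁻ z, f (Function.update w i z) ∂(μ i) ∂(Measure.infinitePi μ) := by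
  have hm := measurable_update_pair (X := X) i
  conv_lhs => rw [← map_update_infinitePi μ i]
  rw [lintegral_map hf hm]
  exact lintegral_prod _ (hf.comp hm).aemeasurable

/-- The law of one noise vector. -/
noncomputable def stepLaw (dx : ℕ) (σ : ℝ) : Measure (Fin dx → ℝ) :=
  Measure.pi fun _ : Fin dx => gaussianReal 0 (Real.toNNReal (σ ^ 2))

instance (dx : ℕ) (σ : ℝ) : IsProbabilityMeasure (stepLaw dx σ) := by
  unfold stepLaw; infer_instance

instance (dx : ℕ) (σ : ℝ) : IsProbabilityMeasure (noiseLaw dx σ) := by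
  unfold noiseLaw; infer_instance

/-- Resampling the noise of time `t`. -/
lemma lintegral_noise_prod_update {dx : ℕ} (σ : ℝ) {Y : Type*} [MeasurableSpace Y]
    (ν : Measure Y) [IsProbabilityMeasure ν] (t : ℕ) {f : (ℕ → Fin dx → ℝ) × Y → ℝ≥0∞}
    (hf : Measurable f) :
    ∫⁻ ω, f ω ∂((noiseLaw dx σ).prod ν) =
      ∫⁻ ω, ∫⁻ z, f (Function.update ω.1 t z, ω.2) ∂(stepLaw dx σ) ∂((noiseLaw dx σ).prod ν) := by
  have hm : Measurable fun p : ((ℕ → Fin dx → ℝ) × Y) × (Fin dx → ℝ) =>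
      f (Function.update p.1.1 t p.2, p.1.2) := by
    refine hf.comp (Measurable.prodMk ?_ (measurable_snd.comp measurable_fst))
    exact (measurable_update_pair (X := fun _ : ℕ => Fin dx → ℝ) t).comp
      ((measurable_fst.comp measurable_fst).prodMk measurable_snd)
  rw [lintegral_prod_symm _ hf.aemeasurable,
    lintegral_prod_symm _ hm.lintegral_prod_right'.aemeasurable]
  refine lintegral_congr fun y => ?_
  exact lintegral_infinitePi_update
    (fun _ : ℕ => Measure.pi fun _ : Fin dx => gaussianReal 0 (Real.toNNReal (σ ^ 2))) t
    (hf.comp (measurable_id.prodMk measurable_const))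

/-! ### Gaussian estimates -/

/-- The event lies in an interval of length `2 * τ`, because the slope exceeds `δ`, and the Gaussian
density is at most its value at the mean. -/
lemma gaussianReal_smallBall {v : NNReal} (hv : v ≠ 0) {δ τ : ℝ} (hδ : 0 < δ) (hτ : 0 ≤ τ)
    (a : ℝ) {b : ℝ} (hb : δ < |b|) :
    gaussianReal 0 v {z | |a + b * z| < τ * δ} ≤ ENNReal.ofReal (2 * τ / √(2 * Real.pi * v)) := by
  have hb0 : 0 < |b| := hδ.trans hb
  have hsub : {z | |a + b * z| < τ * δ} ⊆ Metric.ball (-a / b) τ := by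
    intro z hz
    rw [Metric.mem_ball, Real.dist_eq]
    have hbne : b ≠ 0 := abs_pos.1 hb0
    have : a + b * z = b * (z - -a / b) := by field_simp; ring
    rw [Set.mem_ofPred_eq, this, abs_mul] at hz
    by_contra hcon
    push Not at hcon
    exact absurd hz (not_lt.2 (by nlinarith [mul_le_mul hb.le hcon hτ hb0.le]))
  have hpdf : ∀ z, gaussianPDF 0 v z ≤ ENNReal.ofReal (√(2 * Real.pi * v))⁻¹ := by
    intro z
    refine ENNReal.ofReal_le_ofReal ?_
    rw [gaussianPDFReal]
    refine mul_le_of_le_one_right (by positivity) (Real.exp_le_one_iff.2 ?_)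
    rw [neg_div]
    exact neg_nonpos.2 (by positivity)
  calc gaussianReal 0 v {z | |a + b * z| < τ * δ}
      ≤ gaussianReal 0 v (Metric.ball (-a / b) τ) := measure_mono hsub
    _ = ∫⁻ z in Metric.ball (-a / b) τ, gaussianPDF 0 v z := gaussianReal_apply 0 hv _
    _ ≤ ∫⁻ _ in Metric.ball (-a / b) τ, ENNReal.ofReal (√(2 * Real.pi * v))⁻¹ :=
        lintegral_mono hpdf
    _ = ENNReal.ofReal (2 * τ / √(2 * Real.pi * v)) := by
        rw [setLIntegral_const, Real.volume_ball, ← ENNReal.ofReal_mul (by positivity)]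
        congr 1
        ring

/-- The width `τ` for which the small ball estimate gives probability at most `1 / 8`. -/
noncomputable def ballWidth (σ : ℝ) : ℝ := √(2 * Real.pi * σ ^ 2) / 16

lemma ballWidth_pos {σ : ℝ} (hσ : 0 < σ) : 0 < ballWidth σ := by
  unfold ballWidth; positivity

/-- Only coordinate `j`, whose coefficient is large, is resampled; the other coordinates just shift
the centre of the interval. -/
lemma stepLaw_smallBall {dx : ℕ} {σ : ℝ} (hσ : 0 < σ) {δ : ℝ} (hδ : 0 < δ) (y d : Fin dx → ℝ)
    {j : Fin dx} (hj : δ < |d j|) :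
    stepLaw dx σ {z | |d ⬝ᵥ (y + z)| < ballWidth σ * δ} ≤ ENNReal.ofReal (1 / 8) := by
  have hv : Real.toNNReal (σ ^ 2) ≠ 0 := by simp [hσ.ne']
  have hms : MeasurableSet {z : Fin dx → ℝ | |d ⬝ᵥ (y + z)| < ballWidth σ * δ} := by
    refine measurableSet_lt ?_ measurable_const
    simp only [dotProduct, Pi.add_apply]
    fun_prop
  rw [← lintegral_indicator_one hms, stepLaw, ← Measure.infinitePi_eq_pi,
    lintegral_infinitePi_update _ j (measurable_one.indicator hms)]
  calc _ ≤ ∫⁻ _ : Fin dx → ℝ, ENNReal.ofReal (1 / 8)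
        ∂(Measure.infinitePi fun _ : Fin dx => gaussianReal 0 (Real.toNNReal (σ ^ 2))) := by
        refine lintegral_mono fun w => ?_
        have hset : ∀ z : ℝ, ({z : Fin dx → ℝ | |d ⬝ᵥ (y + z)| < ballWidth σ * δ}.indicator
            (1 : (Fin dx → ℝ) → ℝ≥0∞)) (Function.update w j z) =
            ({z : ℝ | |(d ⬝ᵥ (y + w) - d j * w j) + d j * z| < ballWidth σ * δ}.indicator
              (1 : ℝ → ℝ≥0∞)) z := by
          intro z
          have : d ⬝ᵥ (y + Function.update w j z) = (d ⬝ᵥ (y + w) - d j * w j) + d j * z := by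
            have e : Function.update w j z = w + Pi.single j (z - w j) := by
              ext k
              by_cases hk : k = j
              · subst hk; simp
              · simp [hk]
            rw [e, ← add_assoc, dotProduct_add, dotProduct_single]
            ring
          simp only [Set.indicator, Set.mem_ofPred_eq, this, Pi.one_apply]
        simp only [hset]
        rw [lintegral_indicator_one (measurableSet_lt (by fun_prop) measurable_const)]
        refine (gaussianReal_smallBall hv hδ (ballWidth_pos hσ).le _ hj).trans_eq ?_
        rw [Real.coe_toNNReal _ (sq_nonneg σ), ballWidth]
        congr 1
        have : √(2 * Real.pi * σ ^ 2) ≠ 0 := by positivity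
        field_simp
        norm_num
    _ = _ := by simp

lemma integrable_quadForm_stepLaw {dx : ℕ} (σ : ℝ) (i j : Fin dx) (a b : ℝ) :
    Integrable (fun z : Fin dx → ℝ => (a + z i) * (b + z j)) (stepLaw dx σ) := by
  have h2 : ∀ i : Fin dx, MemLp (fun z : Fin dx → ℝ => z i) 2 (stepLaw dx σ) := fun i =>
    (memLp_id_gaussianReal' 2 (by simp)).comp_measurePreserving (measurePreserving_eval _ i)
  exact ((memLp_const a).add (h2 i)).integrable_mul ((memLp_const b).add (h2 j))

lemma integral_mul_stepLaw {dx : ℕ} (σ : ℝ) (i j : Fin dx) (a b : ℝ) :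
    ∫ z : Fin dx → ℝ, (a + z i) * (b + z j) ∂(stepLaw dx σ) =
      a * b + if i = j then σ ^ 2 else 0 := by
  have h2 : ∀ i : Fin dx, MemLp (fun z : Fin dx → ℝ => z i) 2 (stepLaw dx σ) := fun i =>
    (memLp_id_gaussianReal' 2 (by simp)).comp_measurePreserving (measurePreserving_eval _ i)
  have h1 : ∀ i : Fin dx, Integrable (fun z : Fin dx → ℝ => z i) (stepLaw dx σ) := fun i =>
    (h2 i).integrable (by norm_num)
  have m1 : ∀ i : Fin dx, ∫ z : Fin dx → ℝ, z i ∂(stepLaw dx σ) = 0 := fun i => by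
    have := (measurePreserving_eval
      (fun _ : Fin dx => gaussianReal 0 (Real.toNNReal (σ ^ 2))) i).map_eq
    have h := integral_map (μ := stepLaw dx σ) (φ := Function.eval i)
      (measurable_pi_apply i).aemeasurable
      (f := fun x : ℝ => x) (by fun_prop)
    rw [stepLaw, this, integral_id_gaussianReal] at h
    exact h.symm
  have hprod : Integrable (fun z : Fin dx → ℝ => z i * z j) (stepLaw dx σ) :=
    (h2 i).integrable_mul (h2 j)
  have m2 : ∫ z : Fin dx → ℝ, z i * z j ∂(stepLaw dx σ) = if i = j then σ ^ 2 else 0 := by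
    split_ifs with hij
    · subst hij
      have := (measurePreserving_eval
        (fun _ : Fin dx => gaussianReal 0 (Real.toNNReal (σ ^ 2))) i).map_eq
      have h := integral_map (μ := stepLaw dx σ) (φ := Function.eval i)
        (measurable_pi_apply i).aemeasurable (f := fun x : ℝ => x * x) (by fun_prop)
      rw [stepLaw, this] at h
      rw [stepLaw]
      refine h.symm.trans ?_
      have hvar := variance_eq_sub (μ := gaussianReal 0 (Real.toNNReal (σ ^ 2)))
        (memLp_id_gaussianReal 2)
      rw [variance_id_gaussianReal] at hvar
      simp only [Pi.pow_apply, id, integral_id_gaussianReal] at hvar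
      simp only [← pow_two]
      rw [Real.coe_toNNReal _ (sq_nonneg σ)] at hvar
      simpa using hvar.symm
    · have hind : IndepFun (fun z : Fin dx → ℝ => z i) (fun z => z j) (stepLaw dx σ) :=
        (iIndepFun_pi (X := fun _ : Fin dx => (id : ℝ → ℝ))
          fun _ => aemeasurable_id).indepFun hij
      have h := hind.integral_mul_eq_mul_integral (h1 i).aestronglyMeasurable
        (h1 j).aestronglyMeasurable
      simpa [m1] using h
  have e : ∀ z : Fin dx → ℝ, (a + z i) * (b + z j) = a * b + (a * z j + (b * z i + z i * z j)) :=
    fun z => by ring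
  simp only [e]
  have i1 := (h1 i).const_mul b
  have i2 := (h1 j).const_mul a
  have i3 : Integrable (fun z : Fin dx → ℝ => b * z i + z i * z j) (stepLaw dx σ) := i1.add hprod
  have i4 : Integrable (fun z : Fin dx → ℝ => a * z j + (b * z i + z i * z j)) (stepLaw dx σ) :=
    i2.add i3
  have e1 : ∫ z : Fin dx → ℝ, (b * z i + z i * z j) ∂(stepLaw dx σ) =
      if i = j then σ ^ 2 else 0 := by
    rw [integral_add i1 hprod, integral_const_mul, m1, m2]; simp
  have e2 : ∫ z : Fin dx → ℝ, (a * z j + (b * z i + z i * z j)) ∂(stepLaw dx σ) =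
      if i = j then σ ^ 2 else 0 := by
    rw [integral_add i2 i3, integral_const_mul, m1, e1]; simp
  rw [integral_add (integrable_const _) i4, e2]
  simp

lemma lintegral_quadForm_stepLaw {dx : ℕ} (σ : ℝ) {P : Matrix (Fin dx) (Fin dx) ℝ}
    (hP : P.PosSemidef) (y : Fin dx → ℝ) :
    ∫⁻ z, ENNReal.ofReal ((y + z) ⬝ᵥ (P *ᵥ (y + z))) ∂(stepLaw dx σ) =
      ENNReal.ofReal (y ⬝ᵥ (P *ᵥ y)) + ENNReal.ofReal (σ ^ 2 * P.trace) := by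
  have hnn : ∀ x : Fin dx → ℝ, 0 ≤ x ⬝ᵥ (P *ᵥ x) := fun x => by
    simpa using hP.dotProduct_mulVec_nonneg x
  have e : ∀ x : Fin dx → ℝ, x ⬝ᵥ (P *ᵥ x) = ∑ i, ∑ j, P i j * (x i * x j) := fun x => by
    simp only [dotProduct, Matrix.mulVec, Finset.mul_sum]
    exact Finset.sum_congr rfl fun i _ => Finset.sum_congr rfl fun j _ => by ring
  have hint : ∀ i j, Integrable (fun z : Fin dx → ℝ => P i j * ((y + z) i * (y + z) j))
      (stepLaw dx σ) := fun i j =>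
    (integrable_quadForm_stepLaw σ i j (y i) (y j)).const_mul (P i j)
  rw [← ofReal_integral_eq_lintegral_ofReal _ (ae_of_all _ fun z => hnn _),
    ← ENNReal.ofReal_add (hnn y) (mul_nonneg (sq_nonneg σ) hP.trace_nonneg)]
  · congr 1
    simp only [e]
    rw [integral_finsetSum _ fun i _ => integrable_finsetSum _ fun j _ => hint i j]
    have e' : ∀ i j, ∫ z, P i j * ((y + z) i * (y + z) j) ∂(stepLaw dx σ) =
        P i j * (y i * y j) + P i j * (if i = j then σ ^ 2 else 0) := fun i j => by
      rw [integral_const_mul, ← mul_add]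
      exact congrArg _ (integral_mul_stepLaw σ i j (y i) (y j))
    rw [Finset.sum_congr rfl fun i _ => (integral_finsetSum _ fun j _ => hint i j).trans
      (Finset.sum_congr rfl fun j _ => e' i j)]
    simp only [Finset.sum_add_distrib]
    simp [Matrix.trace, Finset.mul_sum, mul_comm]
  · simp only [e]
    exact integrable_finsetSum _ fun i _ => integrable_finsetSum _ fun j _ => hint i j

/-! ### Stage costs -/

section Costs

variable {dx du : ℕ} {Rx : Matrix (Fin dx) (Fin dx) ℝ} {Ru : Matrix (Fin du) (Fin du) ℝ}

lemma PosDef_quadForm_nonneg {n : ℕ} {R : Matrix (Fin n) (Fin n) ℝ} (hR : R.PosDef)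
    (x : Fin n → ℝ) : 0 ≤ x ⬝ᵥ (R *ᵥ x) := by
  simpa using hR.posSemidef.dotProduct_mulVec_nonneg x

lemma stageCost_nonneg (hRx : Rx.PosDef) (hRu : Ru.PosDef) (x : Fin dx → ℝ) (u : Fin du → ℝ) :
    0 ≤ stageCost Rx Ru x u :=
  add_nonneg (PosDef_quadForm_nonneg hRx x) (PosDef_quadForm_nonneg hRu u)

lemma measurable_quadForm {n : ℕ} (R : Matrix (Fin n) (Fin n) ℝ) :
    Measurable fun x : Fin n → ℝ => x ⬝ᵥ (R *ᵥ x) := by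
  simp only [dotProduct, Matrix.mulVec]; fun_prop

lemma measurable_mulVec {m n : ℕ} (M : Matrix (Fin m) (Fin n) ℝ) :
    Measurable fun x : Fin n → ℝ => M *ᵥ x := by
  unfold Matrix.mulVec dotProduct; fun_prop

/-- The average cost of the optimal gain of `sysOfGain Rx Ru K`. -/
noncomputable def valueRate (Rx : Matrix (Fin dx) (Fin dx) ℝ) (Ru : Matrix (Fin du) (Fin du) ℝ)
    (σ : ℝ) (K : Gain dx du) : ℝ :=
  σ ^ 2 * (valueMatrix Rx Ru K).trace

lemma valueRate_nonneg (hRx : Rx.PosDef) (hRu : Ru.PosDef) (σ : ℝ) (K : Gain dx du) :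
    0 ≤ valueRate Rx Ru σ K :=
  mul_nonneg (sq_nonneg σ) (valueMatrix_posDef hRx hRu K).posSemidef.trace_nonneg

/-! ### The optimal cost is at most the value rate -/

lemma measurable_stationaryState (θ : LinSys dx du) (K : Gain dx du) (t : ℕ) :
    Measurable fun w : ℕ → Fin dx → ℝ => stationaryState θ K w t := by
  induction t with
  | zero => exact measurable_const
  | succ t ih =>
    simp only [stationaryState]
    exact (((measurable_mulVec _).comp ih).add
      ((measurable_mulVec _).comp ((measurable_mulVec _).comp ih))).add (measurable_pi_apply t)

lemma stationaryState_update (θ : LinSys dx du) (K : Gain dx du) (w : ℕ → Fin dx → ℝ) (t : ℕ)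
    (z : Fin dx → ℝ) : ∀ s ≤ t,
    stationaryState θ K (Function.update w t z) s = stationaryState θ K w s
  | 0, _ => rfl
  | s + 1, hs => by
    simp only [stationaryState, stationaryState_update θ K w t z s (by omega)]
    rw [Function.update_of_ne (by omega)]

/-- This is the Bellman identity with zero deviation, in expectation; the fresh noise adds `σ ^ 2 *
trace P` to the next value. -/
lemma stationary_cost_step (hRx : Rx.PosDef) (hRu : Ru.PosDef) (σ : ℝ) (K : Gain dx du) (t : ℕ) :
    ∫⁻ w, ENNReal.ofReal (stageCost Rx Ru (stationaryState (sysOfGain Rx Ru K) K w t)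
        (K *ᵥ stationaryState (sysOfGain Rx Ru K) K w t)) ∂(noiseLaw dx σ) +
      ∫⁻ w, ENNReal.ofReal (stationaryState (sysOfGain Rx Ru K) K w (t + 1) ⬝ᵥ
        (valueMatrix Rx Ru K *ᵥ stationaryState (sysOfGain Rx Ru K) K w (t + 1)))
          ∂(noiseLaw dx σ) =
    ∫⁻ w, ENNReal.ofReal (stationaryState (sysOfGain Rx Ru K) K w t ⬝ᵥ
        (valueMatrix Rx Ru K *ᵥ stationaryState (sysOfGain Rx Ru K) K w t)) ∂(noiseLaw dx σ) +
      ENNReal.ofReal (valueRate Rx Ru σ K) := by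
  set θ := sysOfGain Rx Ru K with hθ
  set P := valueMatrix Rx Ru K with hPd
  have hP : P.PosDef := valueMatrix_posDef hRx hRu K
  have hm := measurable_stationaryState θ K
  have hV : ∀ t, Measurable fun w : ℕ → Fin dx → ℝ =>
      ENNReal.ofReal (stationaryState θ K w t ⬝ᵥ (P *ᵥ stationaryState θ K w t)) := fun t =>
    ((measurable_quadForm P).comp (hm t)).ennreal_ofReal
  have hnext : ∫⁻ w, ENNReal.ofReal (stationaryState θ K w (t + 1) ⬝ᵥ
        (P *ᵥ stationaryState θ K w (t + 1))) ∂(noiseLaw dx σ) =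
      ∫⁻ w, ENNReal.ofReal ((θ.1 *ᵥ stationaryState θ K w t +
          θ.2 *ᵥ (K *ᵥ stationaryState θ K w t)) ⬝ᵥ
        (P *ᵥ (θ.1 *ᵥ stationaryState θ K w t + θ.2 *ᵥ (K *ᵥ stationaryState θ K w t))))
          ∂(noiseLaw dx σ) + ENNReal.ofReal (valueRate Rx Ru σ K) := by
    have h := lintegral_infinitePi_update
      (fun _ : ℕ => Measure.pi fun _ : Fin dx => gaussianReal 0 (Real.toNNReal (σ ^ 2))) t
      (hV (t + 1))
    refine h.trans ?_
    have h2 : ∀ w : ℕ → Fin dx → ℝ, ∫⁻ z, ENNReal.ofReal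
        (stationaryState θ K (Function.update w t z) (t + 1) ⬝ᵥ
          (P *ᵥ stationaryState θ K (Function.update w t z) (t + 1))) ∂(stepLaw dx σ) =
        ENNReal.ofReal ((θ.1 *ᵥ stationaryState θ K w t +
            θ.2 *ᵥ (K *ᵥ stationaryState θ K w t)) ⬝ᵥ
          (P *ᵥ (θ.1 *ᵥ stationaryState θ K w t + θ.2 *ᵥ (K *ᵥ stationaryState θ K w t)))) +
          ENNReal.ofReal (valueRate Rx Ru σ K) := by
      intro w
      simp only [stationaryState, stationaryState_update θ K w t _ t le_rfl, Function.update_self]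
      exact lintegral_quadForm_stepLaw σ hP.posSemidef _
    refine (lintegral_congr h2).trans ?_
    rw [lintegral_add_right _ measurable_const, lintegral_const]
    simp only [measure_univ, mul_one]
    rfl
  have hc : Measurable fun w : ℕ → Fin dx → ℝ => ENNReal.ofReal
      (stageCost Rx Ru (stationaryState θ K w t) (K *ᵥ stationaryState θ K w t)) :=
    (((measurable_quadForm Rx).comp (hm t)).add
      ((measurable_quadForm Ru).comp ((measurable_mulVec K).comp (hm t)))).ennreal_ofReal
  rw [hnext, ← add_assoc, ← lintegral_add_left hc]
  congr 1
  refine lintegral_congr fun w => ?_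
  rw [← ENNReal.ofReal_add (stageCost_nonneg hRx hRu _ _) (PosDef_quadForm_nonneg hP _),
    bellman_sysOfGain hRx hRu K]
  simp [hPd]

/-- Only this direction is needed: a larger benchmark only weakens the upper bound on the cost that
the regret hypothesis supplies. -/
lemma optCost_le (hRx : Rx.PosDef) (hRu : Ru.PosDef) (σ : ℝ) (K : Gain dx du) :
    optCost Rx Ru σ (sysOfGain Rx Ru K) ≤ ENNReal.ofReal (valueRate Rx Ru σ K) := by
  set θ := sysOfGain Rx Ru K with hθ
  refine (iInf_le _ K).trans (limsup_le_of_le (by isBoundedDefault) (Eventually.of_forall fun T => ?_))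
  refine ENNReal.div_le_of_le_mul' ?_
  have hc : ∀ t, Measurable fun w : ℕ → Fin dx → ℝ => ENNReal.ofReal
      (stageCost Rx Ru (stationaryState θ K w t) (K *ᵥ stationaryState θ K w t)) := fun t =>
    (((measurable_quadForm Rx).comp (measurable_stationaryState θ K t)).add
      ((measurable_quadForm Ru).comp
        ((measurable_mulVec K).comp (measurable_stationaryState θ K t)))).ennreal_ofReal
  simp only [ENNReal.ofReal_sum_of_nonneg fun _ _ => stageCost_nonneg hRx hRu _ _]
  rw [lintegral_finsetSum _ fun t _ => hc t]
  -- With the terminal value added, the sum telescopes exactly to `T` times the rate, because the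
  -- initial state is `0`.
  refine le_trans (le_self_add (b := ∫⁻ w, ENNReal.ofReal (stationaryState θ K w T ⬝ᵥ
        (valueMatrix Rx Ru K *ᵥ stationaryState θ K w T)) ∂(noiseLaw dx σ))) (le_of_eq ?_)
  induction T with
  | zero => simp [stationaryState]
  | succ T ih =>
    rw [Finset.sum_range_succ, add_assoc, stationary_cost_step hRx hRu σ K T, ← add_assoc, ih]
    push_cast
    ring

end Costs

/-! ### Runs of a scheme -/

instance : MeasurableSpace (List Bool) := ⊤

instance : DiscreteMeasurableSpace (List Bool) := ⟨fun _ => trivial⟩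

namespace UplinkScheme

variable {dx du : ℕ} (S : UplinkScheme dx du) (θ : LinSys dx du)

instance (σ : ℝ) : IsProbabilityMeasure (S.runLaw σ) := by
  unfold runLaw; infer_instance

lemma measurable_message_pair (t : ℕ) :
    Measurable fun p : (S.PlantSeed × S.CtrlSeed) × (Fin (t + 1) → Fin dx → ℝ) =>
      S.message θ t p.1 p.2 :=
  measurable_to_countable' fun l => S.measurable_message θ t l

lemma measurable_gain_pair (t : ℕ) (i : Fin du) (j : Fin dx) :
    Measurable fun p : S.CtrlSeed × List Bool => S.gain t p.1 p.2 i j :=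
  measurable_from_prod_countable_left fun l => S.measurable_gain t l i j

lemma measurable_history (t : ℕ) : Measurable fun ω : S.Run => S.history θ ω t := by
  induction t with
  | zero =>
    exact measurable_const.prodMk ((S.measurable_message_pair θ 0).comp
      (measurable_snd.prodMk measurable_const))
  | succ t ih =>
    have hs : Measurable fun ω : S.Run => (S.history θ ω t).1 := measurable_fst.comp ih
    have hl : Measurable fun ω : S.Run => (S.history θ ω t).2 := measurable_snd.comp ih
    have hx : Measurable fun ω : S.Run => (S.history θ ω t).1 (Fin.last t) :=
      (measurable_pi_apply _).comp hs
    have hu : Measurable fun ω : S.Run =>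
        S.gain t ω.2.2 (S.history θ ω t).2 *ᵥ (S.history θ ω t).1 (Fin.last t) := by
      refine measurable_pi_iff.2 fun i => ?_
      simp only [Matrix.mulVec, dotProduct]
      refine Finset.measurable_sum _ fun j _ => Measurable.mul ?_ ((measurable_pi_apply j).comp hx)
      exact (S.measurable_gain_pair t i j).comp ((measurable_snd.comp measurable_snd).prodMk hl)
    have hnew : Measurable fun ω : S.Run => θ.1 *ᵥ (S.history θ ω t).1 (Fin.last t) +
        θ.2 *ᵥ (S.gain t ω.2.2 (S.history θ ω t).2 *ᵥ (S.history θ ω t).1 (Fin.last t)) +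
          ω.1 t :=
      (((measurable_mulVec _).comp hx).add ((measurable_mulVec _).comp hu)).add
        ((measurable_pi_apply t).comp measurable_fst)
    have hstates : Measurable fun ω : S.Run => (S.history θ ω (t + 1)).1 := by
      refine measurable_pi_iff.2 fun i => ?_
      refine Fin.lastCases ?_ (fun i => ?_) i
      · simpa [history] using hnew
      · simp only [history, Fin.snoc_castSucc]
        exact (measurable_pi_apply i).comp hs
    refine hstates.prodMk ?_
    have happ : Measurable fun p : List Bool × List Bool => p.1 ++ p.2 :=
      measurable_from_prod_countable_left fun l => measurable_from_top
    exact happ.comp (hl.prodMk ((S.measurable_message_pair θ (t + 1)).comp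
      (measurable_snd.prodMk hstates)))

/-- Causality: the noise of index `t` first enters the state of time `t + 1`, so it is fresh given
the history up to `t`. -/
lemma history_update (ω : S.Run) (t : ℕ) (z : Fin dx → ℝ) : ∀ s ≤ t,
    S.history θ (Function.update ω.1 t z, ω.2) s = S.history θ ω s
  | 0, _ => rfl
  | s + 1, hs => by
    simp only [history, history_update ω t z s (by omega)]
    rw [Function.update_of_ne (by omega)]

/-- The next state without the noise. -/
def drift (ω : S.Run) (t : ℕ) : Fin dx → ℝ :=
  θ.1 *ᵥ S.state θ ω t + θ.2 *ᵥ S.input θ ω t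

lemma state_succ (ω : S.Run) (t : ℕ) : S.state θ ω (t + 1) = S.drift θ ω t + ω.1 t := by
  simp [state, drift, input, transcript, history]

lemma transcript_succ (ω : S.Run) (t : ℕ) : S.transcript θ ω (t + 1) =
    S.transcript θ ω t ++ S.message θ (t + 1) ω.2 (S.history θ ω (t + 1)).1 := rfl

lemma measurable_state (t : ℕ) : Measurable fun ω : S.Run => S.state θ ω t :=
  (measurable_pi_apply _).comp (measurable_fst.comp (S.measurable_history θ t))

lemma measurable_transcript (t : ℕ) : Measurable fun ω : S.Run => S.transcript θ ω t :=
  measurable_snd.comp (S.measurable_history θ t)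

lemma measurable_gain_transcript (t s : ℕ) (i : Fin du) (j : Fin dx) :
    Measurable fun ω : S.Run => S.gain t ω.2.2 (S.transcript θ ω s) i j :=
  (S.measurable_gain_pair t i j).comp
    ((measurable_snd.comp measurable_snd).prodMk (S.measurable_transcript θ s))

lemma measurable_input (t : ℕ) : Measurable fun ω : S.Run => S.input θ ω t := by
  refine measurable_pi_iff.2 fun i => ?_
  simp only [input, Matrix.mulVec, dotProduct]
  exact Finset.measurable_sum _ fun j _ => (S.measurable_gain_transcript θ t t i j).mul
    ((measurable_pi_apply j).comp (S.measurable_state θ t))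

lemma measurable_drift (t : ℕ) : Measurable fun ω : S.Run => S.drift θ ω t :=
  ((measurable_mulVec _).comp (S.measurable_state θ t)).add
    ((measurable_mulVec _).comp (S.measurable_input θ t))

lemma drift_update (ω : S.Run) (t : ℕ) (z : Fin dx → ℝ) :
    S.drift θ (Function.update ω.1 t z, ω.2) t = S.drift θ ω t := by
  simp only [drift, input, state, transcript, S.history_update θ ω t z t le_rfl]

/-! ### Lower bound on the cost of a scheme -/

variable {Rx : Matrix (Fin dx) (Fin dx) ℝ} {Ru : Matrix (Fin du) (Fin du) ℝ}

/-- The expected value function at time `t`. -/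
noncomputable def expValue (Rx : Matrix (Fin dx) (Fin dx) ℝ) (Ru : Matrix (Fin du) (Fin du) ℝ)
    (σ : ℝ) (K : Gain dx du) (t : ℕ) : ℝ≥0∞ :=
  ∫⁻ ω, ENNReal.ofReal (S.state (sysOfGain Rx Ru K) ω t ⬝ᵥ
    (valueMatrix Rx Ru K *ᵥ S.state (sysOfGain Rx Ru K) ω t)) ∂(S.runLaw σ)

/-- The weighted squared deviation of the input of time `t` from the input under gain `K`. -/
noncomputable def deviation (Rx : Matrix (Fin dx) (Fin dx) ℝ) (Ru : Matrix (Fin du) (Fin du) ℝ)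
    (K : Gain dx du) (t : ℕ) (ω : S.Run) : ℝ :=
  (S.input (sysOfGain Rx Ru K) ω t - K *ᵥ S.state (sysOfGain Rx Ru K) ω t) ⬝ᵥ
    (Ru *ᵥ (S.input (sysOfGain Rx Ru K) ω t - K *ᵥ S.state (sysOfGain Rx Ru K) ω t))

lemma measurable_deviation (K : Gain dx du) (t : ℕ) : Measurable (S.deviation Rx Ru K t) :=
  (measurable_quadForm Ru).comp ((S.measurable_input _ t).sub
    ((measurable_mulVec K).comp (S.measurable_state _ t)))

/-- The expected stage cost at time `t`. -/
noncomputable def expStageCost (Rx : Matrix (Fin dx) (Fin dx) ℝ) (Ru : Matrix (Fin du) (Fin du) ℝ)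
    (σ : ℝ) (t : ℕ) : ℝ≥0∞ :=
  ∫⁻ ω, ENNReal.ofReal (stageCost Rx Ru (S.state θ ω t) (S.input θ ω t)) ∂(S.runLaw σ)

lemma measurable_stageCost (t : ℕ) : Measurable fun ω : S.Run =>
    ENNReal.ofReal (stageCost Rx Ru (S.state θ ω t) (S.input θ ω t)) :=
  (((measurable_quadForm Rx).comp (S.measurable_state θ t)).add
    ((measurable_quadForm Ru).comp (S.measurable_input θ t))).ennreal_ofReal

lemma expectedCost_eq_sum (hRx : Rx.PosDef) (hRu : Ru.PosDef) (σ : ℝ) (T : ℕ) :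
    S.expectedCost Rx Ru σ θ T = ∑ t ∈ Finset.range T, S.expStageCost θ Rx Ru σ t := by
  unfold expectedCost expStageCost
  simp only [ENNReal.ofReal_sum_of_nonneg fun _ _ => stageCost_nonneg hRx hRu _ _]
  exact lintegral_finsetSum _ fun t _ => S.measurable_stageCost θ t

lemma expValue_succ (hRx : Rx.PosDef) (hRu : Ru.PosDef) (σ : ℝ) (K : Gain dx du) (t : ℕ) :
    S.expValue Rx Ru σ K (t + 1) =
      ∫⁻ ω, ENNReal.ofReal (S.drift (sysOfGain Rx Ru K) ω t ⬝ᵥ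
        (valueMatrix Rx Ru K *ᵥ S.drift (sysOfGain Rx Ru K) ω t)) ∂(S.runLaw σ) +
      ENNReal.ofReal (valueRate Rx Ru σ K) := by
  have hP := valueMatrix_posDef hRx hRu K
  have hm : Measurable fun ω : S.Run => ENNReal.ofReal
      (S.state (sysOfGain Rx Ru K) ω (t + 1) ⬝ᵥ
        (valueMatrix Rx Ru K *ᵥ S.state (sysOfGain Rx Ru K) ω (t + 1))) :=
    ((measurable_quadForm _).comp (S.measurable_state _ (t + 1))).ennreal_ofReal
  rw [expValue, runLaw, lintegral_noise_prod_update σ _ t hm]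
  simp only [state_succ, drift_update, Function.update_self,
    lintegral_quadForm_stepLaw σ hP.posSemidef]
  rw [lintegral_add_right _ measurable_const, lintegral_const, measure_univ, mul_one]
  rfl

/-- A convex combination of two lower bounds on the stage cost: the Bellman identity with weight
`η`, and `V / 3 ≤ cost`, which follows from `hK`, with weight `1 - η`. The second raises the weight
on the value at time `t` above the weight at `t + 1`. -/
lemma cost_step (hRx : Rx.PosDef) (hRu : Ru.PosDef) (σ : ℝ) {K : Gain dx du}
    (hK : ∀ x, x ⬝ᵥ (valueMatrix Rx Ru K *ᵥ x) ≤ 3 * (x ⬝ᵥ (Rx *ᵥ x))) (t : ℕ)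
    {η : ℝ} (h0 : 0 ≤ η) (h1 : η ≤ 1) :
    ENNReal.ofReal (η + (1 - η) / 3) * S.expValue Rx Ru σ K t +
      ENNReal.ofReal η * (ENNReal.ofReal (valueRate Rx Ru σ K) +
        ∫⁻ ω, ENNReal.ofReal (S.deviation Rx Ru K t ω) ∂(S.runLaw σ)) ≤
    S.expStageCost (sysOfGain Rx Ru K) Rx Ru σ t +
      ENNReal.ofReal η * S.expValue Rx Ru σ K (t + 1) := by
  have hP := valueMatrix_posDef hRx hRu K
  rw [S.expValue_succ hRx hRu, mul_add, mul_add, add_comm (ENNReal.ofReal η * ENNReal.ofReal _),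
    ← add_assoc, ← add_assoc]
  refine add_le_add_left ?_ _
  have m1 : Measurable fun ω : S.Run => ENNReal.ofReal
      (S.state (sysOfGain Rx Ru K) ω t ⬝ᵥ
        (valueMatrix Rx Ru K *ᵥ S.state (sysOfGain Rx Ru K) ω t)) :=
    ((measurable_quadForm _).comp (S.measurable_state _ t)).ennreal_ofReal
  have m2 := (S.measurable_deviation (Rx := Rx) (Ru := Ru) K t).ennreal_ofReal
  have m3 : Measurable fun ω : S.Run => ENNReal.ofReal
      (S.drift (sysOfGain Rx Ru K) ω t ⬝ᵥ
        (valueMatrix Rx Ru K *ᵥ S.drift (sysOfGain Rx Ru K) ω t)) :=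
    ((measurable_quadForm _).comp (S.measurable_drift _ t)).ennreal_ofReal
  rw [expValue, expStageCost, ← lintegral_const_mul _ m1, ← lintegral_const_mul _ m2,
    ← lintegral_const_mul _ m3, ← lintegral_add_left (m1.const_mul _),
    ← lintegral_add_left (S.measurable_stageCost _ t)]
  refine lintegral_mono fun ω => ?_
  have hv := PosDef_quadForm_nonneg hP (S.state (sysOfGain Rx Ru K) ω t)
  have hd := PosDef_quadForm_nonneg hRu
    (S.input (sysOfGain Rx Ru K) ω t - K *ᵥ S.state (sysOfGain Rx Ru K) ω t)
  have hdr := PosDef_quadForm_nonneg hP (S.drift (sysOfGain Rx Ru K) ω t)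
  have hc := stageCost_nonneg hRx hRu (S.state (sysOfGain Rx Ru K) ω t)
    (S.input (sysOfGain Rx Ru K) ω t)
  have hη : 0 ≤ η + (1 - η) / 3 := by linarith
  simp only [deviation]
  rw [← ENNReal.ofReal_mul h0, ← ENNReal.ofReal_mul h0, ← ENNReal.ofReal_mul hη,
    ← ENNReal.ofReal_add (mul_nonneg hη hv) (mul_nonneg h0 hd),
    ← ENNReal.ofReal_add hc (mul_nonneg h0 hdr)]
  refine ENNReal.ofReal_le_ofReal ?_
  have hb := bellman_sysOfGain hRx hRu K (S.state (sysOfGain Rx Ru K) ω t)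
    (S.input (sysOfGain Rx Ru K) ω t)
  have hk := hK (S.state (sysOfGain Rx Ru K) ω t)
  have hu := PosDef_quadForm_nonneg hRu (S.input (sysOfGain Rx Ru K) ω t)
  have hx := PosDef_quadForm_nonneg hP (inputMatrix Rx Ru K *ᵥ
    (S.input (sysOfGain Rx Ru K) ω t - K *ᵥ S.state (sysOfGain Rx Ru K) ω t))
  simp only [drift]
  set c := stageCost Rx Ru (S.state (sysOfGain Rx Ru K) ω t) (S.input (sysOfGain Rx Ru K) ω t)
    with hcdef
  have hcv : (S.state (sysOfGain Rx Ru K) ω t ⬝ᵥ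
      (valueMatrix Rx Ru K *ᵥ S.state (sysOfGain Rx Ru K) ω t)) / 3 ≤ c := by
    rw [hcdef, stageCost]; linarith
  have key1 := mul_le_mul_of_nonneg_left hcv (sub_nonneg.2 h1)
  have key2 := mul_nonneg h0 hx
  have key3 := congrArg (η * ·) hb
  linarith

/-- The weights of the finite-horizon lower bounds on the value function. -/
noncomputable def horizonWeight (k : ℕ) : ℝ := 1 - (2 / 3) ^ k

/-- Induction on the number `k` of remaining rounds. The weight starts at `0`, so no terminal value
appears, and the recursion `η ↦ η + (1 - η) / 3` produces `horizonWeight`. -/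
lemma cost_lower_bound (hRx : Rx.PosDef) (hRu : Ru.PosDef) (σ : ℝ) {K : Gain dx du}
    (hK : ∀ x, x ⬝ᵥ (valueMatrix Rx Ru K *ᵥ x) ≤ 3 * (x ⬝ᵥ (Rx *ᵥ x))) (k : ℕ) : ∀ t : ℕ,
    ENNReal.ofReal (horizonWeight k) * S.expValue Rx Ru σ K t +
      ∑ s ∈ Finset.range k, ENNReal.ofReal (horizonWeight (k - 1 - s)) *
        (ENNReal.ofReal (valueRate Rx Ru σ K) +
          ∫⁻ ω, ENNReal.ofReal (S.deviation Rx Ru K (t + s) ω) ∂(S.runLaw σ)) ≤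
    ∑ s ∈ Finset.range k, S.expStageCost (sysOfGain Rx Ru K) Rx Ru σ (t + s) := by
  induction k with
  | zero => intro t; simp [horizonWeight]
  | succ k ih =>
    intro t
    have h0 : 0 ≤ horizonWeight k := sub_nonneg.2 (pow_le_one₀ (by norm_num) (by norm_num))
    have h1 : horizonWeight k ≤ 1 := sub_le_self _ (by positivity)
    have hs : horizonWeight (k + 1) = horizonWeight k + (1 - horizonWeight k) / 3 := by
      unfold horizonWeight; ring
    have step := S.cost_step hRx hRu σ hK t h0 h1
    have hi := ih (t + 1)
    rw [Finset.sum_range_succ', Finset.sum_range_succ', hs]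
    simp only [add_zero, Nat.add_sub_cancel, Nat.sub_zero]
    have e1 : ∀ s, t + 1 + s = t + (s + 1) := fun s => by ring
    have e2 : ∀ s, k - 1 - s = k - (s + 1) := fun s => by omega
    simp only [e1, e2] at hi
    calc _ = (ENNReal.ofReal (horizonWeight k + (1 - horizonWeight k) / 3) *
              S.expValue Rx Ru σ K t +
            ENNReal.ofReal (horizonWeight k) * (ENNReal.ofReal (valueRate Rx Ru σ K) +
              ∫⁻ ω, ENNReal.ofReal (S.deviation Rx Ru K t ω) ∂(S.runLaw σ))) + _ := by
            rw [add_comm (Finset.sum _ _), ← add_assoc]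
      _ ≤ (S.expStageCost (sysOfGain Rx Ru K) Rx Ru σ t +
            ENNReal.ofReal (horizonWeight k) * S.expValue Rx Ru σ K (t + 1)) + _ :=
          add_le_add_left step _
      _ ≤ _ := by
          rw [add_assoc, add_comm (Finset.sum _ _)]
          exact add_le_add_right hi _

end UplinkScheme

/-! ### Sum of the weights and number of short transcripts -/

lemma sum_horizonWeight (T : ℕ) :
    ∑ s ∈ Finset.range T, UplinkScheme.horizonWeight s = T - 3 + 3 * (2 / 3) ^ T := by
  induction T with
  | zero => simp
  | succ T ih =>
    rw [Finset.sum_range_succ, ih, UplinkScheme.horizonWeight]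
    push_cast
    ring

/-- The bit strings of length at most `b`. -/
def shortLists (b : ℕ) : Finset (List Bool) :=
  (Finset.range (b + 1)).biUnion fun k =>
    (Finset.univ : Finset (Fin k → Bool)).image List.ofFn

lemma mem_shortLists {b : ℕ} {l : List Bool} (h : l.length ≤ b) : l ∈ shortLists b :=
  Finset.mem_biUnion.2 ⟨l.length, Finset.mem_range.2 (by omega),
    Finset.mem_image.2 ⟨l.get, Finset.mem_univ _, List.ofFn_get l⟩⟩

lemma card_shortLists_le (b : ℕ) : (shortLists b).card ≤ 2 ^ (b + 1) := by
  refine Finset.card_biUnion_le.trans ?_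
  calc ∑ k ∈ Finset.range (b + 1),
        ((Finset.univ : Finset (Fin k → Bool)).image List.ofFn).card
      ≤ ∑ k ∈ Finset.range (b + 1), 2 ^ k := Finset.sum_le_sum fun k _ =>
        Finset.card_image_le.trans (by simp)
    _ ≤ 2 ^ (b + 1) := (Nat.geomSum_lt le_rfl (by simp)).le

/-! ### From a regret bound to a bound on the deviations -/

namespace UplinkScheme

variable {dx du : ℕ} (S : UplinkScheme dx du)
  {Rx : Matrix (Fin dx) (Fin dx) ℝ} {Ru : Matrix (Fin du) (Fin du) ℝ}

lemma expectedCost_le_of_regret {σ J c : ℝ} (hJ : 0 ≤ J) {Θ : Set (LinSys dx du)} {T : ℕ}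
    {θ : LinSys dx du} (hθ : θ ∈ Θ) (hopt : optCost Rx Ru σ θ ≤ ENNReal.ofReal J)
    (h : S.worstCaseRegret Rx Ru σ Θ T ≤ (c : EReal)) :
    S.expectedCost Rx Ru σ θ T ≤ ENNReal.ofReal (c + T * J) := by
  have h1 : S.expectedRegret Rx Ru σ θ T ≤ (c : EReal) :=
    (le_iSup₂ (f := fun θ (_ : θ ∈ Θ) => S.expectedRegret Rx Ru σ θ T) θ hθ).trans h
  have h2 : (T : ℝ≥0∞) * optCost Rx Ru σ θ ≤ ENNReal.ofReal (T * J) := by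
    rw [ENNReal.ofReal_mul (Nat.cast_nonneg T), ENNReal.ofReal_natCast]
    gcongr
  have h3 : (((T : ℝ≥0∞) * optCost Rx Ru σ θ : ℝ≥0∞) : EReal) ≤ ((T * J : ℝ) : EReal) := by
    refine (EReal.coe_ennreal_le_coe_ennreal_iff.2 h2).trans ?_
    rw [EReal.coe_ennreal_ofReal, max_eq_left (by positivity)]
  rw [expectedRegret, EReal.sub_le_iff_le_add (Or.inr (EReal.coe_ne_top c))
    (Or.inr (EReal.coe_ne_bot c))] at h1
  have h4 : ((S.expectedCost Rx Ru σ θ T : ℝ≥0∞) : EReal) ≤ ((c + T * J : ℝ) : EReal) := by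
    rw [EReal.coe_add]
    exact h1.trans (add_le_add_right h3 _)
  have := EReal.toENNReal_le_toENNReal h4
  rwa [EReal.toENNReal_coe, EReal.real_coe_toENNReal] at this

/-- The weights sum to at least `T - 3`, so the noise part of the cost falls short of `T * J` by at
most `3 * J`. All weights but the last are at least `1 / 3`, whence the factor `3`. -/
lemma sum_deviation_le (hRx : Rx.PosDef) (hRu : Ru.PosDef) {σ : ℝ} {K : Gain dx du}
    (hK : ∀ x, x ⬝ᵥ (valueMatrix Rx Ru K *ᵥ x) ≤ 3 * (x ⬝ᵥ (Rx *ᵥ x))) {T : ℕ} (hT : 3 ≤ T)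
    {c : ℝ} (hc : S.expectedCost Rx Ru σ (sysOfGain Rx Ru K) T ≤
      ENNReal.ofReal (c + T * valueRate Rx Ru σ K)) :
    ∑ s ∈ Finset.range (T - 1), ∫⁻ ω, ENNReal.ofReal (S.deviation Rx Ru K s ω) ∂(S.runLaw σ) ≤
      ENNReal.ofReal (3 * (c + 3 * valueRate Rx Ru σ K)) := by
  set J := valueRate Rx Ru σ K with hJdef
  have hJ : 0 ≤ J := valueRate_nonneg hRx hRu σ K
  set q : ℕ → ℝ≥0∞ := fun s => ∫⁻ ω, ENNReal.ofReal (S.deviation Rx Ru K s ω) ∂(S.runLaw σ)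
    with hq
  have hw0 : ∀ k, 0 ≤ horizonWeight k := fun k =>
    sub_nonneg.2 (pow_le_one₀ (by norm_num) (by norm_num))
  have hw1 : ∀ k, 1 ≤ k → 1 / 3 ≤ horizonWeight k := fun k hk => by
    have := pow_le_pow_of_le_one (a := (2 / 3 : ℝ)) (by norm_num) (by norm_num) hk
    rw [horizonWeight]; linarith
  have hlb := S.cost_lower_bound hRx hRu σ hK T 0
  simp only [zero_add] at hlb
  rw [← S.expectedCost_eq_sum _ hRx hRu] at hlb
  have hlb2 : ∑ s ∈ Finset.range T, ENNReal.ofReal (horizonWeight (T - 1 - s)) *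
      (ENNReal.ofReal J + q s) ≤ ENNReal.ofReal (c + T * J) :=
    (le_add_self.trans hlb).trans hc
  simp only [mul_add, Finset.sum_add_distrib] at hlb2
  have hT3 : (0 : ℝ) ≤ (T - 3) * J :=
    mul_nonneg (sub_nonneg.2 (by exact_mod_cast hT)) hJ
  have e1 : ENNReal.ofReal ((T - 3) * J) ≤
      ∑ s ∈ Finset.range T, ENNReal.ofReal (horizonWeight (T - 1 - s)) * ENNReal.ofReal J := by
    rw [← Finset.sum_mul, ← ENNReal.ofReal_sum_of_nonneg fun s _ => hw0 _,
      Finset.sum_range_reflect (fun s => horizonWeight s) T, sum_horizonWeight,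
      ← ENNReal.ofReal_mul' hJ]
    refine ENNReal.ofReal_le_ofReal (mul_le_mul_of_nonneg_right ?_ hJ)
    linarith [pow_pos (show (0 : ℝ) < 2 / 3 by norm_num) T]
  -- The last round has weight `0` and is dropped; this is why the sum stops at `T - 1`.
  have e2 : ENNReal.ofReal (1 / 3) * ∑ s ∈ Finset.range (T - 1), q s ≤
      ∑ s ∈ Finset.range T, ENNReal.ofReal (horizonWeight (T - 1 - s)) * q s := by
    rw [Finset.mul_sum]
    refine le_trans (Finset.sum_le_sum fun s hs => ?_)
      (Finset.sum_le_sum_of_subset (Finset.range_mono (Nat.sub_le T 1)))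
    have := Finset.mem_range.1 hs
    exact mul_le_mul_left (ENNReal.ofReal_le_ofReal (hw1 _ (by omega))) _
  have e3 := (add_le_add e1 e2).trans hlb2
  have e4 : ENNReal.ofReal (1 / 3) * ∑ s ∈ Finset.range (T - 1), q s ≤
      ENNReal.ofReal (c + 3 * J) := by
    have := ENNReal.le_sub_of_add_le_left ENNReal.ofReal_ne_top e3
    rw [← ENNReal.ofReal_sub _ hT3] at this
    refine this.trans_eq (congrArg _ (by ring))
  calc ∑ s ∈ Finset.range (T - 1), q s
      = ENNReal.ofReal 3 * (ENNReal.ofReal (1 / 3) * ∑ s ∈ Finset.range (T - 1), q s) := by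
        rw [← mul_assoc, ← ENNReal.ofReal_mul (by norm_num)]; norm_num
    _ ≤ ENNReal.ofReal 3 * ENNReal.ofReal (c + 3 * J) := mul_le_mul_right e4 _
    _ = _ := by rw [← ENNReal.ofReal_mul (by norm_num)]

/-! ### Identification of the gain from the transcript -/

/-- The gain that the transcript of time `t` prescribes for time `t + 1` if nothing is sent. -/
def silentGain (θ : LinSys dx du) (t : ℕ) (ω : S.Run) : Gain dx du :=
  S.gain (t + 1) ω.2.2 (S.transcript θ ω t)

/-- The event that the prescribed gain is within `δ` of `K`, entrywise. -/
def closeEvent (θ : LinSys dx du) (K : Gain dx du) (δ : ℝ) (t : ℕ) : Set S.Run :=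
  {ω | ∀ i j, |S.silentGain θ t ω i j - K i j| ≤ δ}

/-- The event that bits are sent at time `t + 1`. -/
def sendEvent (θ : LinSys dx du) (t : ℕ) : Set S.Run :=
  {ω | S.message θ (t + 1) ω.2 (S.history θ ω (t + 1)).1 ≠ []}

/-- The event that the prescribed gain is wrong but the next state does not reveal it. -/
def hiddenEvent (θ : LinSys dx du) (K : Gain dx du) (δ ρ : ℝ) (t : ℕ) : Set S.Run :=
  {ω | (∃ i j, δ < |(S.silentGain θ t ω - K) i j|) ∧
    ∀ i, |(S.silentGain θ t ω - K) i ⬝ᵥ S.state θ ω (t + 1)| < ρ}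

lemma measurable_silentGain (θ : LinSys dx du) (t : ℕ) (i : Fin du) (j : Fin dx) :
    Measurable fun ω => S.silentGain θ t ω i j :=
  S.measurable_gain_transcript θ (t + 1) t i j

lemma measurableSet_closeEvent (θ : LinSys dx du) (K : Gain dx du) (δ : ℝ) (t : ℕ) :
    MeasurableSet (S.closeEvent θ K δ t) := by
  simp only [closeEvent, Set.ofPred_forall]
  refine MeasurableSet.iInter fun i => MeasurableSet.iInter fun j => ?_
  have := S.measurable_silentGain θ t i j
  exact measurableSet_le (by fun_prop) measurable_const

lemma measurableSet_sendEvent (θ : LinSys dx du) (t : ℕ) :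
    MeasurableSet (S.sendEvent θ t) := by
  have hm : Measurable fun ω : S.Run => S.message θ (t + 1) ω.2 (S.history θ ω (t + 1)).1 :=
    (S.measurable_message_pair θ (t + 1)).comp
      (measurable_snd.prodMk (measurable_fst.comp (S.measurable_history θ (t + 1))))
  exact (hm (measurableSet_singleton [])).compl

lemma measurableSet_hiddenEvent (θ : LinSys dx du) (K : Gain dx du) (δ ρ : ℝ) (t : ℕ) :
    MeasurableSet (S.hiddenEvent θ K δ ρ t) := by
  have hg := S.measurable_silentGain θ t
  have hx := fun j => (measurable_pi_apply j).comp (S.measurable_state θ (t + 1))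
  have h1 : MeasurableSet {ω : S.Run | ∃ i j, δ < |(S.silentGain θ t ω - K) i j|} := by
    simp only [Set.ofPred_exists]
    refine MeasurableSet.iUnion fun i => MeasurableSet.iUnion fun j => ?_
    refine measurableSet_lt measurable_const ?_
    have := hg i j
    simp only [Matrix.sub_apply]
    fun_prop
  have h2 : MeasurableSet {ω : S.Run |
      ∀ i, |(S.silentGain θ t ω - K) i ⬝ᵥ S.state θ ω (t + 1)| < ρ} := by
    simp only [Set.ofPred_forall]
    refine MeasurableSet.iInter fun i => measurableSet_lt ?_ measurable_const
    have hsum : Measurable fun ω : S.Run =>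
        (S.silentGain θ t ω - K) i ⬝ᵥ S.state θ ω (t + 1) := by
      simp only [dotProduct]
      refine Finset.measurable_sum _ fun j _ => ?_
      exact ((hg i j).sub measurable_const).mul (hx j)
    exact measurable_norm.comp hsum
  exact h1.inter h2

/-- The prescribed gain depends only on the history up to `t` and the seeds, while the next state is
drift plus fresh noise. Resampling that noise reduces the claim to `stepLaw_smallBall` for one wrong
row. -/
lemma measure_hiddenEvent_le {σ : ℝ} (hσ : 0 < σ) (θ : LinSys dx du) (K : Gain dx du) {δ : ℝ}
    (hδ : 0 < δ) (t : ℕ) :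
    S.runLaw σ (S.hiddenEvent θ K δ (ballWidth σ * δ) t) ≤ ENNReal.ofReal (1 / 8) := by
  have hm := S.measurableSet_hiddenEvent θ K δ (ballWidth σ * δ) t
  rw [← lintegral_indicator_one hm, runLaw,
    lintegral_noise_prod_update σ _ t (measurable_one.indicator hm)]
  calc _ ≤ ∫⁻ _, ENNReal.ofReal (1 / 8) ∂(S.runLaw σ) := lintegral_mono fun ω => ?_
    _ = ENNReal.ofReal (1 / 8) := by rw [lintegral_const, measure_univ, mul_one]
  have hsil : ∀ z, S.silentGain θ t (Function.update ω.1 t z, ω.2) = S.silentGain θ t ω := by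
    intro z
    simp only [silentGain, transcript, S.history_update θ ω t z t le_rfl]
  by_cases hex : ∃ i j, δ < |(S.silentGain θ t ω - K) i j|
  · obtain ⟨i, j, hij⟩ := hex
    refine le_trans ?_ (stepLaw_smallBall hσ hδ (S.drift θ ω t) ((S.silentGain θ t ω - K) i) hij)
    refine (lintegral_mono fun z => ?_).trans (lintegral_indicator_one_le
      {z | |(S.silentGain θ t ω - K) i ⬝ᵥ (S.drift θ ω t + z)| < ballWidth σ * δ})
    by_cases hz : (Function.update ω.1 t z, ω.2) ∈ S.hiddenEvent θ K δ (ballWidth σ * δ) t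
    · have h2 := hz.2 i
      rw [hsil, state_succ, drift_update] at h2
      simp only [Function.update_self] at h2
      rw [Set.indicator_of_mem hz, Set.indicator_of_mem (by exact h2)]
      rfl
    · rw [Set.indicator_of_notMem hz]
      exact zero_le
  · refine le_trans (le_of_eq ?_) (zero_le)
    rw [lintegral_eq_zero_iff' ?_]
    · refine Eventually.of_forall fun z => Set.indicator_of_notMem (fun hz => hex ?_) _
      simpa only [hsil] using hz.1
    · refine (Measurable.comp (measurable_one.indicator hm) ?_).aemeasurable
      refine Measurable.prodMk ?_ measurable_const
      exact measurable_update ω.1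

/-- Outside the sending, hidden and close events the deviation at `t + 1` is at least `c * ρ ^ 2`;
Markov's inequality bounds the probability of this. -/
lemma one_le_of_events {σ : ℝ} (hσ : 0 < σ) (K : Gain dx du) {c : ℝ} (hc : 0 < c)
    (hcR : ∀ u, c * (u ⬝ᵥ u) ≤ u ⬝ᵥ (Ru *ᵥ u)) {δ : ℝ} (hδ : 0 < δ) (t : ℕ) :
    1 ≤ S.runLaw σ (S.sendEvent (sysOfGain Rx Ru K) t) + ENNReal.ofReal (1 / 8) +
      (∫⁻ ω, ENNReal.ofReal (S.deviation Rx Ru K (t + 1) ω) ∂(S.runLaw σ)) /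
        ENNReal.ofReal (c * (ballWidth σ * δ) ^ 2) +
      S.runLaw σ (S.closeEvent (sysOfGain Rx Ru K) K δ t) := by
  set θ := sysOfGain Rx Ru K with hθ
  set ρ := ballWidth σ * δ with hρ
  have hρ0 : 0 < ρ := mul_pos (ballWidth_pos hσ) hδ
  have hpos : 0 < c * ρ ^ 2 := by positivity
  set Q : Set S.Run := {ω | ENNReal.ofReal (c * ρ ^ 2) ≤
    ENNReal.ofReal (S.deviation Rx Ru K (t + 1) ω)} with hQ
  have hQm : S.runLaw σ Q ≤ (∫⁻ ω, ENNReal.ofReal (S.deviation Rx Ru K (t + 1) ω) ∂(S.runLaw σ)) /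
      ENNReal.ofReal (c * ρ ^ 2) :=
    meas_ge_le_lintegral_div (S.measurable_deviation K (t + 1)).ennreal_ofReal.aemeasurable
      (ENNReal.ofReal_pos.2 hpos).ne' ENNReal.ofReal_ne_top
  have hcover : (Set.univ : Set S.Run) ⊆ S.sendEvent θ t ∪ S.hiddenEvent θ K δ ρ t ∪ Q ∪
      S.closeEvent θ K δ t := by
    intro ω _
    by_contra hcon
    simp only [Set.mem_union, not_or] at hcon
    obtain ⟨⟨⟨h1, h2⟩, h3⟩, h4⟩ := hcon
    have h4' : ∃ i j, δ < |(S.silentGain θ t ω - K) i j| := by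
      by_contra hne
      push Not at hne
      exact h4 fun i j => hne i j
    have h2' : ∃ i, ρ ≤ |(S.silentGain θ t ω - K) i ⬝ᵥ S.state θ ω (t + 1)| := by
      by_contra hne
      push Not at hne
      exact h2 ⟨h4', hne⟩
    obtain ⟨i, hi⟩ := h2'
    have hmsg : S.message θ (t + 1) ω.2 (S.history θ ω (t + 1)).1 = [] := not_not.1 h1
    have htr : S.transcript θ ω (t + 1) = S.transcript θ ω t := by
      rw [transcript_succ, hmsg, List.append_nil]
    have hv : S.input θ ω (t + 1) - K *ᵥ S.state θ ω (t + 1) =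
        (S.silentGain θ t ω - K) *ᵥ S.state θ ω (t + 1) := by
      rw [input, htr, Matrix.sub_mulVec, silentGain]
    refine h3 (ENNReal.ofReal_le_ofReal ?_)
    rw [deviation, ← hθ, hv]
    refine le_trans ?_ (hcR _)
    refine mul_le_mul_of_nonneg_left ?_ hc.le
    calc ρ ^ 2 ≤ |(S.silentGain θ t ω - K) i ⬝ᵥ S.state θ ω (t + 1)| ^ 2 := by gcongr
      _ = ((S.silentGain θ t ω - K) *ᵥ S.state θ ω (t + 1)) i *
          ((S.silentGain θ t ω - K) *ᵥ S.state θ ω (t + 1)) i := by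
          rw [sq_abs, pow_two]; rfl
      _ ≤ _ := Finset.single_le_sum (f := fun i =>
          ((S.silentGain θ t ω - K) *ᵥ S.state θ ω (t + 1)) i *
          ((S.silentGain θ t ω - K) *ᵥ S.state θ ω (t + 1)) i)
          (fun i _ => mul_self_nonneg _) (Finset.mem_univ i)
  calc (1 : ℝ≥0∞) = S.runLaw σ Set.univ := measure_univ.symm
    _ ≤ S.runLaw σ (S.sendEvent θ t ∪ S.hiddenEvent θ K δ ρ t ∪ Q ∪ S.closeEvent θ K δ t) :=
        measure_mono hcover
    _ ≤ S.runLaw σ (S.sendEvent θ t) + S.runLaw σ (S.hiddenEvent θ K δ ρ t) + S.runLaw σ Q +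
        S.runLaw σ (S.closeEvent θ K δ t) := by
        refine (measure_union_le _ _).trans (add_le_add_left ?_ _)
        refine (measure_union_le _ _).trans (add_le_add_left ?_ _)
        exact measure_union_le _ _
    _ ≤ _ := by
        gcongr
        exact S.measure_hiddenEvent_le hσ θ K hδ t

lemma transcript_length_mono (θ : LinSys dx du) (ω : S.Run) :
    Monotone fun t => (S.transcript θ ω t).length :=
  monotone_nat_of_le_succ fun t => by rw [transcript_succ, List.length_append]; omega

/-- Each nonempty message costs at least one bit. -/
lemma sum_sendEvent_indicator_le (θ : LinSys dx du) (ω : S.Run) (n : ℕ) :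
    ∑ t ∈ Finset.range n, (S.sendEvent θ t).indicator (1 : S.Run → ℝ≥0∞) ω ≤
      ((S.transcript θ ω n).length : ℝ≥0∞) := by
  induction n with
  | zero => simp
  | succ n ih =>
    rw [Finset.sum_range_succ, transcript_succ, List.length_append, Nat.cast_add]
    refine add_le_add ih ?_
    by_cases h : ω ∈ S.sendEvent θ n
    · rw [Set.indicator_of_mem h]
      have : 1 ≤ (S.message θ (n + 1) ω.2 (S.history θ ω (n + 1)).1).length :=
        List.length_pos_iff.2 h
      simpa using (Nat.one_le_cast (α := ℝ≥0∞)).2 this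
    · rw [Set.indicator_of_notMem h]
      exact zero_le

lemma sum_measure_sendEvent_le {σ : ℝ} {θ : LinSys dx du} {T b n : ℕ} (hn : n ≤ T - 1)
    (h : ∀ᵐ ω ∂(S.runLaw σ), (S.transcript θ ω (T - 1)).length ≤ b) :
    ∑ t ∈ Finset.range n, S.runLaw σ (S.sendEvent θ t) ≤ b := by
  have hm := S.measurableSet_sendEvent θ
  calc ∑ t ∈ Finset.range n, S.runLaw σ (S.sendEvent θ t)
      = ∫⁻ ω, ∑ t ∈ Finset.range n, (S.sendEvent θ t).indicator (1 : S.Run → ℝ≥0∞) ω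
          ∂(S.runLaw σ) := by
        rw [lintegral_finsetSum _ fun t _ => measurable_one.indicator (hm t)]
        simp only [lintegral_indicator_one (hm _)]
    _ ≤ ∫⁻ _, (b : ℝ≥0∞) ∂(S.runLaw σ) := by
        refine lintegral_mono_ae ?_
        filter_upwards [h] with ω hω
        refine (S.sum_sendEvent_indicator_le θ ω n).trans ?_
        exact_mod_cast (S.transcript_length_mono θ ω hn).trans hω
    _ = b := by rw [lintegral_const, measure_univ, mul_one]

/-- At a fixed time the transcripts of at most `b` bits identify few gains. -/
lemma sum_measure_closeEvent_le {σ : ℝ} {ι : Type*} [Fintype ι] (κ : ι → Gain dx du)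
    (θ : ι → LinSys dx du) {δ : ℝ}
    (hsep : ∀ f g, (∀ i j, |κ f i j - κ g i j| ≤ 2 * δ) → f = g) {T b t : ℕ} (ht : t ≤ T - 1)
    (h : ∀ f, ∀ᵐ ω ∂(S.runLaw σ), (S.transcript (θ f) ω (T - 1)).length ≤ b) :
    ∑ f, S.runLaw σ (S.closeEvent (θ f) (κ f) δ t) ≤ 2 ^ (b + 1) := by
  classical
  have hm := fun f => S.measurableSet_closeEvent (θ f) (κ f) δ t
  calc ∑ f, S.runLaw σ (S.closeEvent (θ f) (κ f) δ t)
      = ∫⁻ ω, ∑ f, (S.closeEvent (θ f) (κ f) δ t).indicator (1 : S.Run → ℝ≥0∞) ω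
          ∂(S.runLaw σ) := by
        rw [lintegral_finsetSum _ fun f _ => measurable_one.indicator (hm f)]
        simp only [lintegral_indicator_one (hm _)]
    _ ≤ ∫⁻ _, (2 ^ (b + 1) : ℝ≥0∞) ∂(S.runLaw σ) := by
        refine lintegral_mono_ae ?_
        filter_upwards [ae_all_iff.2 h] with ω hω
        have hcard : (Finset.univ.filter fun f => ω ∈ S.closeEvent (θ f) (κ f) δ t).card ≤
            2 ^ (b + 1) := by
          -- For fixed `ω` two systems with the same transcript receive the same silent gain. If it
          -- is `δ`-close to both targets, these are within `2 * δ`, hence equal.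
          refine le_trans (Finset.card_le_card_of_injOn (t := shortLists b)
            (fun f => S.transcript (θ f) ω t) ?_ ?_) (card_shortLists_le b)
          · intro f _
            exact mem_shortLists ((S.transcript_length_mono (θ f) ω ht).trans (hω f))
          · intro f hf g hg hfg
            have hf' : ω ∈ S.closeEvent (θ f) (κ f) δ t := by simpa using hf
            have hg' : ω ∈ S.closeEvent (θ g) (κ g) δ t := by simpa using hg
            refine hsep f g fun i j => ?_
            have h1 := hf' i j
            have h2 := hg' i j
            simp only [silentGain] at h1 h2
            simp only at hfg
            rw [← hfg] at h2
            rw [abs_le] at h1 h2 ⊢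
            constructor <;> linarith [h1.1, h1.2, h2.1, h2.2]
        have : ∑ f, (S.closeEvent (θ f) (κ f) δ t).indicator (1 : S.Run → ℝ≥0∞) ω =
            ((Finset.univ.filter fun f => ω ∈ S.closeEvent (θ f) (κ f) δ t).card : ℝ≥0∞) := by
          simp [Set.indicator_apply]
        rw [this]
        exact_mod_cast hcard
    _ = _ := by rw [lintegral_const, measure_univ, mul_one]

/-- The counting inequality for a separated family of gains. -/
lemma counting_inequality {σ : ℝ} (hσ : 0 < σ) {c : ℝ} (hc : 0 < c)
    (hcR : ∀ u, c * (u ⬝ᵥ u) ≤ u ⬝ᵥ (Ru *ᵥ u)) {ι : Type*} [Fintype ι] (κ : ι → Gain dx du)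
    {δ : ℝ} (hδ : 0 < δ) (hsep : ∀ f g, (∀ i j, |κ f i j - κ g i j| ≤ 2 * δ) → f = g)
    {n b : ℕ}
    (h : ∀ f, ∀ᵐ ω ∂(S.runLaw σ), (S.transcript (sysOfGain Rx Ru (κ f)) ω (n + 1)).length ≤ b)
    {R : ℝ} (hR0 : 0 ≤ R)
    (hR : ∀ f, ∑ s ∈ Finset.range (n + 1),
      ∫⁻ ω, ENNReal.ofReal (S.deviation Rx Ru (κ f) s ω) ∂(S.runLaw σ) ≤ ENNReal.ofReal R) :
    (n : ℝ) * Fintype.card ι ≤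
      Fintype.card ι * (b + n / 8 + R / (c * (ballWidth σ * δ) ^ 2)) + n * 2 ^ (b + 1) := by
  have hτ := ballWidth_pos hσ
  have hG : 0 < c * (ballWidth σ * δ) ^ 2 := by positivity
  have hsum : ∀ f, (n : ℝ≥0∞) ≤ ENNReal.ofReal (b + n / 8 + R / (c * (ballWidth σ * δ) ^ 2)) +
      ∑ t ∈ Finset.range n, S.runLaw σ (S.closeEvent (sysOfGain Rx Ru (κ f)) (κ f) δ t) := by
    intro f
    have h1 := Finset.sum_le_sum fun t (_ : t ∈ Finset.range n) =>
      S.one_le_of_events (Rx := Rx) hσ (κ f) hc hcR hδ t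
    simp only [Finset.sum_add_distrib, Finset.sum_const, Finset.card_range, nsmul_eq_mul,
      mul_one] at h1
    refine h1.trans (add_le_add_left ?_ _)
    have h2 := S.sum_measure_sendEvent_le (T := n + 1 + 1) (n := n) (by omega) (h f)
    have h3 : ∑ t ∈ Finset.range n,
        (∫⁻ ω, ENNReal.ofReal (S.deviation Rx Ru (κ f) (t + 1) ω) ∂(S.runLaw σ)) /
          ENNReal.ofReal (c * (ballWidth σ * δ) ^ 2) ≤
        ENNReal.ofReal (R / (c * (ballWidth σ * δ) ^ 2)) := by
      rw [ENNReal.ofReal_div_of_pos hG]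
      simp only [div_eq_mul_inv]
      rw [← Finset.sum_mul]
      refine mul_le_mul_left (le_trans ?_ (hR f)) _
      -- The events concern the deviations at times `t + 1`, so the term of time `0` is discarded.
      rw [Finset.sum_range_succ']
      exact le_self_add
    have hR' : 0 ≤ R / (c * (ballWidth σ * δ) ^ 2) := by positivity
    rw [ENNReal.ofReal_add (by positivity) hR', ENNReal.ofReal_add (by positivity) (by positivity),
      ENNReal.ofReal_natCast]
    have h4 : (n : ℝ≥0∞) * ENNReal.ofReal (1 / 8) = ENNReal.ofReal (n / 8) := by
      rw [← ENNReal.ofReal_natCast, ← ENNReal.ofReal_mul (Nat.cast_nonneg n)]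
      congr 1
      ring
    rw [h4]
    exact add_le_add (add_le_add_left h2 _) h3
  have htot := Finset.sum_le_sum fun f (_ : f ∈ (Finset.univ : Finset ι)) => hsum f
  simp only [Finset.sum_add_distrib, Finset.sum_const, Finset.card_univ, nsmul_eq_mul] at htot
  -- Exchanging the sums allows the count over the family to be made separately at each time.
  rw [Finset.sum_comm] at htot
  have hclose : ∑ t ∈ Finset.range n, ∑ f,
      S.runLaw σ (S.closeEvent (sysOfGain Rx Ru (κ f)) (κ f) δ t) ≤ (n : ℝ≥0∞) * 2 ^ (b + 1) := by
    refine (Finset.sum_le_sum fun t ht => S.sum_measure_closeEvent_le κ _ hsep (T := n + 2)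
      (b := b) ?_ h).trans_eq (by simp)
    have := Finset.mem_range.1 ht
    omega
  have hfin := htot.trans (add_le_add_right hclose _)
  have hX : 0 ≤ b + n / 8 + R / (c * (ballWidth σ * δ) ^ 2) := by positivity
  have e : (Fintype.card ι : ℝ≥0∞) * ENNReal.ofReal (b + n / 8 + R / (c * (ballWidth σ * δ) ^ 2)) +
      (n : ℝ≥0∞) * 2 ^ (b + 1) = ENNReal.ofReal (Fintype.card ι *
        (b + n / 8 + R / (c * (ballWidth σ * δ) ^ 2)) + n * 2 ^ (b + 1)) := by
    rw [ENNReal.ofReal_add (mul_nonneg (Nat.cast_nonneg _) hX) (by positivity),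
      ENNReal.ofReal_mul (Nat.cast_nonneg _), ENNReal.ofReal_mul (by positivity), ENNReal.ofReal_natCast, ENNReal.ofReal_natCast,
      ENNReal.ofReal_pow (by norm_num)]
    norm_num
  rw [e] at hfin
  have e' : (Fintype.card ι : ℝ≥0∞) * n = ENNReal.ofReal (n * Fintype.card ι) := by
    rw [ENNReal.ofReal_mul (by positivity), ENNReal.ofReal_natCast, ENNReal.ofReal_natCast, mul_comm]
  rw [e'] at hfin
  exact (ENNReal.ofReal_le_ofReal_iff (by positivity)).1 hfin

end UplinkScheme

/-! ### From the counting inequality to a logarithmic bound -/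

/-- The constant in the converse, for `d` gain entries and grid scale `s`. -/
noncomputable def converseConst (d s : ℝ) : ℝ :=
  2 + d + d * |Real.logb 2 s| + |d / (4 * Real.log 2) * Real.log (2 * d / Real.log 2)|

/-- Elementary consequence of the counting inequality. -/
lemma bits_lower_bound {d : ℕ} (hd : 1 ≤ d) {s : ℝ} (hs : 0 < s) {α : ℝ}
    (hα : α ∈ Set.Ico (1 / 2 : ℝ) 1) {T b : ℕ} (hT : 1 ≤ T)
    (h : 4 ≤ T → 1 ≤ s * (T : ℝ) ^ ((1 - α) / 2) → ∀ m : ℕ, 0 < m →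
      (m : ℝ) ≤ s * (T : ℝ) ^ ((1 - α) / 2) →
      ((T - 2 : ℕ) : ℝ) * m ^ d ≤ m ^ d * (b + (T - 2 : ℕ) / 8 + (T - 2 : ℕ) / 8) +
        (T - 2 : ℕ) * 2 ^ (b + 1)) :
    (d : ℝ) / 2 * (1 - α) * Real.logb 2 T - converseConst d s ≤ b := by
  obtain ⟨hα0, hα1⟩ := hα
  have hd1 : (1 : ℝ) ≤ d := by exact_mod_cast hd
  have hT1 : (1 : ℝ) ≤ T := by exact_mod_cast hT
  have hT0 : (0 : ℝ) < T := by linarith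
  have hb0 : (0 : ℝ) ≤ b := Nat.cast_nonneg b
  have hln : 0 < Real.log 2 := Real.log_pos (by norm_num)
  have hL0 : 0 ≤ Real.logb 2 T := Real.logb_nonneg (by norm_num) hT1
  have habs1 := abs_nonneg (Real.logb 2 s)
  have habs2 := abs_nonneg (d / (4 * Real.log 2) * Real.log (2 * d / Real.log 2))
  have hds : 0 ≤ (d : ℝ) * |Real.logb 2 s| := by positivity
  have hpow : (0 : ℝ) < (T : ℝ) ^ ((1 - α) / 2) := Real.rpow_pos_of_pos hT0 _
  have hlogx : Real.logb 2 (s * (T : ℝ) ^ ((1 - α) / 2)) =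
      Real.logb 2 s + (1 - α) / 2 * Real.logb 2 T := by
    rw [Real.logb_mul hs.ne' hpow.ne', Real.logb_rpow_eq_mul_logb_of_pos hT0]
  unfold converseConst
  by_cases hT4 : 4 ≤ T
  swap
  -- For `T < 4` the main term is at most `d`, one of the summands of the constant.
  · have : Real.logb 2 T ≤ 2 := by
      rw [Real.logb_le_iff_le_rpow (by norm_num) hT0]
      have : (T : ℝ) ≤ 4 := by exact_mod_cast (not_le.1 hT4).le
      norm_num
      linarith
    have h1 : (d : ℝ) / 2 * (1 - α) * Real.logb 2 T ≤ d / 2 * 1 * 2 := by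
      gcongr
      linarith
    linarith
  by_cases hx : 1 ≤ s * (T : ℝ) ^ ((1 - α) / 2)
  swap
  · have h1 : Real.logb 2 (s * (T : ℝ) ^ ((1 - α) / 2)) ≤ 0 :=
      Real.logb_nonpos (by norm_num) (by positivity) (not_le.1 hx).le
    rw [hlogx] at h1
    have h2 : (1 - α) / 2 * Real.logb 2 T ≤ |Real.logb 2 s| := by
      linarith [neg_abs_le (Real.logb 2 s)]
    have h3 := mul_le_mul_of_nonneg_left h2 (by linarith : (0 : ℝ) ≤ d)
    linarith
  have hn : ((T - 2 : ℕ) : ℝ) = T - 2 := by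
    rw [Nat.cast_sub (by omega)]; norm_num
  have hT4' : (4 : ℝ) ≤ T := by exact_mod_cast hT4
  -- If `b` is already linear in `T` it beats the logarithm: `a` is chosen so that `log y ≤ y` at `y
  -- = T / a` bounds the main term by `T / 8` plus a constant. Otherwise half of the rounds remain
  -- for the close events, which gives `m ^ d ≤ 2 ^ (b + 2)`.
  by_cases hb : ((T - 2 : ℕ) : ℝ) / 4 ≤ b
  · rw [hn] at hb
    set a : ℝ := 2 * d / Real.log 2 with ha
    have ha0 : 0 < a := by positivity
    have h1 : Real.log (T / a) ≤ T / a := (Real.log_le_sub_one_of_pos (by positivity)).trans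
      (by linarith)
    rw [Real.log_div hT0.ne' ha0.ne'] at h1
    have h2 : (d : ℝ) / 2 * (1 - α) * Real.logb 2 T ≤ d / 2 * (1 / 2) * Real.logb 2 T := by
      gcongr
      linarith
    have h3 : (d : ℝ) / 2 * (1 / 2) * Real.logb 2 T = d / (4 * Real.log 2) * Real.log T := by
      rw [Real.logb]; field_simp; ring
    have h4 : d / (4 * Real.log 2) * Real.log T ≤ d / (4 * Real.log 2) * (T / a + Real.log a) :=
      mul_le_mul_of_nonneg_left (by linarith) (by positivity)
    have h5 : d / (4 * Real.log 2) * (T / a) = T / 8 := by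
      rw [ha]; field_simp; norm_num
    have h6 := le_abs_self (d / (4 * Real.log 2) * Real.log a)
    rw [mul_add, h5] at h4
    linarith
  · push Not at hb
    set x := s * (T : ℝ) ^ ((1 - α) / 2) with hxdef
    have hm0 : 0 < ⌊x⌋₊ := Nat.floor_pos.2 hx
    set m := ⌊x⌋₊ with hm
    have hcount := h hT4 hx m hm0 (Nat.floor_le (by linarith))
    have hM : (0 : ℝ) < (m : ℝ) ^ d := by positivity
    have hn0 : (0 : ℝ) < ((T - 2 : ℕ) : ℝ) := by rw [hn]; linarith
    have h1 : (m : ℝ) ^ d ≤ 2 ^ (b + 2) := by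
      have h2 : (m : ℝ) ^ d * b ≤ m ^ d * ((T - 2 : ℕ) / 4) :=
        mul_le_mul_of_nonneg_left hb.le hM.le
      have h3 : ((T - 2 : ℕ) : ℝ) * m ^ d ≤ ((T - 2 : ℕ) : ℝ) * 2 ^ (b + 2) := by
        rw [pow_succ 2 (b + 1)]
        linarith
      exact le_of_mul_le_mul_left h3 hn0
    -- Rounding down loses at most a factor `2` per gain entry, hence the `d` in the constant; the
    -- `2` comes from the exponent `b + 2`.
    have hmx : x / 2 ≤ m := by
      have := Nat.lt_floor_add_one x
      have : (1 : ℝ) ≤ m := by exact_mod_cast hm0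
      linarith
    have h4 : (x / 2) ^ d ≤ 2 ^ (b + 2) := (pow_le_pow_left₀ (by positivity) hmx d).trans h1
    have h5 := Real.logb_le_logb_of_le (b := 2) (by norm_num) (by positivity) h4
    rw [Real.logb_pow, Real.logb_pow, Real.logb_div (by positivity) (by norm_num), hlogx,
      Real.logb_self_eq_one (by norm_num)] at h5
    push_cast at h5
    have h6 := mul_le_mul_of_nonneg_left (neg_abs_le (Real.logb 2 s)) (by linarith : (0 : ℝ) ≤ d)
    linarith

/-! ### The grid of gains and the converse over the cube -/

section Converse

variable {dx du : ℕ} {Rx : Matrix (Fin dx) (Fin dx) ℝ} {Ru : Matrix (Fin du) (Fin du) ℝ}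

lemma valueRate_le {σ : ℝ} {K : Gain dx du}
    (hK : ∀ x, x ⬝ᵥ (valueMatrix Rx Ru K *ᵥ x) ≤ 3 * (x ⬝ᵥ (Rx *ᵥ x))) :
    valueRate Rx Ru σ K ≤ σ ^ 2 * (3 * Rx.trace) := by
  refine mul_le_mul_of_nonneg_left ?_ (sq_nonneg σ)
  rw [Matrix.trace, Matrix.trace, Finset.mul_sum]
  refine Finset.sum_le_sum fun i _ => ?_
  simpa using hK (Pi.single i 1)

/-- The gains with entries in `{0, ε / m, …, (m - 1) ε / m}`. -/
noncomputable def gridGain (ε : ℝ) (m : ℕ) (f : Fin du → Fin dx → Fin m) : Gain dx du :=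
  Matrix.of fun i j => ε / m * (f i j : ℕ)

lemma abs_gridGain_le {ε : ℝ} (hε : 0 < ε) {m : ℕ} (hm : 0 < m) (f : Fin du → Fin dx → Fin m)
    (i : Fin du) (j : Fin dx) : |gridGain ε m f i j| ≤ ε := by
  have hm' : (0 : ℝ) < m := by exact_mod_cast hm
  have h : ((f i j : ℕ) : ℝ) ≤ m := by exact_mod_cast (f i j).2.le
  rw [gridGain, Matrix.of_apply, abs_of_nonneg (by positivity), div_mul_eq_mul_div,
    div_le_iff₀ hm']
  exact mul_le_mul_of_nonneg_left h hε.le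

/-- The choice `δ = ε / (3 * m)` keeps `2 * δ` below the grid spacing `ε / m`. -/
lemma gridGain_separated {ε : ℝ} (hε : 0 < ε) {m : ℕ} (hm : 0 < m)
    (f g : Fin du → Fin dx → Fin m)
    (h : ∀ i j, |gridGain ε m f i j - gridGain ε m g i j| ≤ 2 * (ε / (3 * m))) : f = g := by
  have hm' : (0 : ℝ) < m := by exact_mod_cast hm
  funext i j
  have h1 := h i j
  rw [gridGain, gridGain, Matrix.of_apply, Matrix.of_apply, ← mul_sub, abs_mul,
    abs_of_pos (by positivity)] at h1
  have h2 : |((f i j : ℕ) : ℝ) - ((g i j : ℕ) : ℝ)| < 1 := by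
    have : ε / m * |((f i j : ℕ) : ℝ) - ((g i j : ℕ) : ℝ)| ≤ ε / m * (2 / 3) := by
      refine h1.trans_eq ?_
      field_simp
    linarith [le_of_mul_le_mul_left this (by positivity)]
  have h3 : |((f i j : ℕ) : ℤ) - ((g i j : ℕ) : ℤ)| < 1 := by exact_mod_cast h2
  exact Fin.ext (by rw [Int.abs_lt_one_iff] at h3; omega)

/-- Converse over the compact class of systems with small optimal gains. -/
lemma converse_cubeClass (hdx : 0 < dx) (hdu : 0 < du) (hRx : Rx.PosDef) (hRu : Ru.PosDef)
    {ε : ℝ} (hε : 0 < ε) (hK : ∀ K : Gain dx du, (∀ i j, |K i j| ≤ ε) →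
      ∀ x, x ⬝ᵥ (valueMatrix Rx Ru K *ᵥ x) ≤ 3 * (x ⬝ᵥ (Rx *ᵥ x)))
    {σ : ℝ} (hσ : 0 < σ) (C₁ : ℝ) :
    ∃ C : ℝ, ∀ α ∈ Set.Ico (1 / 2 : ℝ) 1, ∀ T : ℕ, 1 ≤ T →
      ∀ Θ : Set (LinSys dx du), cubeClass Rx Ru ε ⊆ Θ →
      ∀ S : UplinkScheme dx du,
        S.worstCaseRegret Rx Ru σ Θ T ≤ ((C₁ * (T : ℝ) ^ α : ℝ) : EReal) →
        ∀ b : ℕ, S.TransmitsAtMost σ (cubeClass Rx Ru ε) T b →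
          ((du : ℝ) * dx / 2) * (1 - α) * Real.logb 2 T - C ≤ b := by
  obtain ⟨c, hc, hcR⟩ := PosDef_exists_lower_bound hRu
  -- As `1 ≤ T ^ α`, the constant `3 * J` is absorbed into `D * T ^ α`, uniformly over the class.
  -- The `+ 1` makes `D` positive.
  set D : ℝ := |C₁| + 3 * (σ ^ 2 * (3 * Rx.trace)) + 1 with hD
  have htr : 0 ≤ Rx.trace := hRx.posSemidef.trace_nonneg
  have hD0 : 0 < D := by positivity
  have hτ := ballWidth_pos hσ
  -- The grid scale is tuned so that the deviation term is at most `T / 16`: it equals `27 * D * T ^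
  -- α * m ^ 2 / (c * (ballWidth σ * ε) ^ 2)`, and `432 = 27 * 16`. For `T ≥ 4` this is at most `(T
  -- - 2) / 8`.
  set s : ℝ := √(c * (ballWidth σ * ε) ^ 2 / (432 * D)) with hs
  have hs0 : 0 < s := by positivity
  have hs2 : s ^ 2 = c * (ballWidth σ * ε) ^ 2 / (432 * D) := Real.sq_sqrt (by positivity)
  refine ⟨converseConst (du * dx : ℕ) s, fun α hα T hT Θ hΘ S hreg b hb => ?_⟩
  have key := bits_lower_bound (d := du * dx) (Nat.mul_pos hdu hdx) hs0 hα hT (b := b) ?_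
  · push_cast at key ⊢
    exact key
  intro hT4 _ m hm hmle
  -- The usable times `t + 1` run from `1` to `T - 2`: time `0` has no earlier transcript, and the
  -- last round is not covered by the deviation bound.
  obtain ⟨n, rfl⟩ : ∃ n, T = n + 2 := ⟨T - 2, by omega⟩
  have hm' : (0 : ℝ) < m := by exact_mod_cast hm
  have hT1 : (1 : ℝ) ≤ ((n + 2 : ℕ) : ℝ) := by exact_mod_cast hT
  have hT0 : (0 : ℝ) < ((n + 2 : ℕ) : ℝ) := by linarith
  have hTα : (1 : ℝ) ≤ ((n + 2 : ℕ) : ℝ) ^ α := Real.one_le_rpow hT1 (by linarith [hα.1])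
  set R : ℝ := 3 * (D * ((n + 2 : ℕ) : ℝ) ^ α) with hRdef
  have hR0 : 0 ≤ R := by positivity
  have hmem : ∀ f : Fin du → Fin dx → Fin m,
      sysOfGain Rx Ru (gridGain ε m f) ∈ cubeClass Rx Ru ε := fun f =>
    ⟨_, abs_gridGain_le hε hm f, rfl⟩
  have hdev : ∀ f : Fin du → Fin dx → Fin m, ∑ t ∈ Finset.range (n + 1),
      ∫⁻ ω, ENNReal.ofReal (S.deviation Rx Ru (gridGain ε m f) t ω) ∂(S.runLaw σ) ≤
        ENNReal.ofReal R := by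
    intro f
    have hKf := hK _ (abs_gridGain_le hε hm f)
    have hcost := S.expectedCost_le_of_regret (valueRate_nonneg hRx hRu σ _) (hΘ (hmem f))
      (optCost_le hRx hRu σ _) hreg
    refine (S.sum_deviation_le hRx hRu hKf (by omega) hcost).trans (ENNReal.ofReal_le_ofReal ?_)
    have h1 := valueRate_le (σ := σ) hKf
    have h2 := mul_le_mul_of_nonneg_right (le_abs_self C₁) (zero_le_one.trans hTα)
    have h3 : 3 * (σ ^ 2 * (3 * Rx.trace)) ≤
        3 * (σ ^ 2 * (3 * Rx.trace)) * ((n + 2 : ℕ) : ℝ) ^ α :=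
      le_mul_of_one_le_right (by positivity) hTα
    rw [hRdef, hD]
    linarith
  have hcount := S.counting_inequality hσ hc hcR (gridGain ε m) (δ := ε / (3 * m))
    (by positivity) (gridGain_separated hε hm) (n := n) (b := b) (fun f => hb _ (hmem f)) hR0 hdev
  have hcard : (Fintype.card (Fin du → Fin dx → Fin m) : ℝ) = (m : ℝ) ^ (du * dx) := by
    simp [← pow_mul, mul_comm]
  have hRbound : R / (c * (ballWidth σ * (ε / (3 * m))) ^ 2) ≤ n / 8 := by
    have hm2 : (m : ℝ) ^ 2 ≤ s ^ 2 * ((n + 2 : ℕ) : ℝ) ^ (1 - α) := by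
      have := pow_le_pow_left₀ hm'.le hmle 2
      rwa [mul_pow, ← Real.rpow_natCast (((n + 2 : ℕ) : ℝ) ^ ((1 - α) / 2)) 2,
        ← Real.rpow_mul hT0.le, Nat.cast_ofNat, div_mul_cancel₀ _ (two_ne_zero)] at this
    have hTT : ((n + 2 : ℕ) : ℝ) ^ α * ((n + 2 : ℕ) : ℝ) ^ (1 - α) = (n + 2 : ℕ) := by
      rw [← Real.rpow_add hT0]; simp
    have hn2 : (2 : ℝ) ≤ n := by exact_mod_cast (by omega : 2 ≤ n)
    calc R / (c * (ballWidth σ * (ε / (3 * m))) ^ 2)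
        = 27 * D * ((n + 2 : ℕ) : ℝ) ^ α / (c * (ballWidth σ * ε) ^ 2) * (m : ℝ) ^ 2 := by
          rw [hRdef]; field_simp; norm_num
      _ ≤ 27 * D * ((n + 2 : ℕ) : ℝ) ^ α / (c * (ballWidth σ * ε) ^ 2) *
          (s ^ 2 * ((n + 2 : ℕ) : ℝ) ^ (1 - α)) :=
          mul_le_mul_of_nonneg_left hm2 (by positivity)
      _ = (((n + 2 : ℕ) : ℝ) ^ α * ((n + 2 : ℕ) : ℝ) ^ (1 - α)) / 16 := by
          rw [hs2]; field_simp; norm_num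
      _ ≤ n / 8 := by rw [hTT]; push_cast; linarith
  rw [hcard] at hcount
  refine hcount.trans (add_le_add_left (mul_le_mul_of_nonneg_left ?_ (by positivity)) _)
  simp only [Nat.add_sub_cancel]
  linarith

end Converse

end RateLimitedLQR

/-! ### Assembly of the two parts -/

theorem mainTheorem1 {dx du : ℕ} (hdx : 0 < dx) (hdu : 0 < du)
    (Rx : Matrix (Fin dx) (Fin dx) ℝ) (Ru : Matrix (Fin du) (Fin du) ℝ)
    (hRx : Rx.PosDef) (hRu : Ru.PosDef) (K₀ : Gain dx du) (r : ℝ) (hr : 0 < r) :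
    ∃ Θ₀ : Set (LinSys dx du),
      IsCompact Θ₀ ∧
      (∀ θ ∈ Θ₀, Stabilizable θ ∧ SchurStable (θ.1 - θ.2 * K₀) ∧
        ∃ K, IsOptimalGain Rx Ru θ K ∧ frobNorm K ≤ r) ∧
      ∀ σ : ℝ, 0 < σ → ∀ C₁ : ℝ,
        (∃ C : ℝ, ∀ α ∈ Set.Ico (1 / 2 : ℝ) 1, ∀ T : ℕ, 1 ≤ T →
          ∀ Θ : Set (LinSys dx du), Θ₀ ⊆ Θ → (∀ θ ∈ Θ, Stabilizable θ) →
          ∀ S : UplinkScheme dx du,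
            S.worstCaseRegret Rx Ru σ Θ T ≤ ((C₁ * (T : ℝ) ^ α : ℝ) : EReal) →
            ∀ b : ℕ, S.TransmitsAtMost σ Θ₀ T b →
              ((du : ℝ) * dx / 2) * (1 - α) * Real.logb 2 T - C ≤ b) ∧
        (∀ α ∈ Set.Ico (1 / 2 : ℝ) 1, ∃ c : ℝ, 0 < c ∧ ∃ T₀ : ℕ, ∀ T : ℕ, T₀ ≤ T →
          ∀ Θ : Set (LinSys dx du), Θ₀ ⊆ Θ → (∀ θ ∈ Θ, Stabilizable θ) →
          ∀ S : UplinkScheme dx du,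
            S.worstCaseRegret Rx Ru σ Θ T ≤ ((C₁ * (T : ℝ) ^ α : ℝ) : EReal) →
            ∀ b : ℕ, S.TransmitsAtMost σ Θ₀ T b →
              c * Real.logb 2 T ≤ b) := by
  obtain ⟨ε, hε, hcube⟩ := exists_cube (dx := dx) (du := du) hRx hRu K₀ hr
  refine ⟨cubeClass Rx Ru ε, isCompact_cubeClass hRx hRu ε, ?_, fun σ hσ C₁ => ?_⟩
  · rintro _ ⟨K, hK, rfl⟩
    obtain ⟨h1, h2, -⟩ := hcube K hK
    exact ⟨stabilizable_sysOfGain K, h2, K, isOptimalGain_sysOfGain hRx hRu K, h1⟩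
  obtain ⟨C, hC⟩ := converse_cubeClass hdx hdu hRx hRu hε (fun K hK => (hcube K hK).2.2) hσ C₁
  refine ⟨⟨C, fun α hα T hT Θ hΘ _ S hreg b hb => hC α hα T hT Θ hΘ S hreg b hb⟩, ?_⟩
  intro α hα
  -- Half of the leading coefficient is kept; the other half of the logarithm eventually exceeds
  -- `C`.
  have hpos : 0 < (du : ℝ) * dx / 4 * (1 - α) := by
    have h1 : (0 : ℝ) < du := by exact_mod_cast hdu
    have h2 : (0 : ℝ) < dx := by exact_mod_cast hdx
    have h3 : 0 < 1 - α := sub_pos.2 hα.2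
    positivity
  have hlim : Tendsto (fun T : ℕ => (du : ℝ) * dx / 4 * (1 - α) * Real.logb 2 T) atTop atTop :=
    ((Real.tendsto_logb_atTop (by norm_num)).comp tendsto_natCast_atTop_atTop).const_mul_atTop hpos
  obtain ⟨T₀, hT₀⟩ := eventually_atTop.1 ((hlim.eventually_ge_atTop C).and (eventually_ge_atTop 1))
  refine ⟨_, hpos, T₀, fun T hT Θ hΘ _ S hreg b hb => ?_⟩
  obtain ⟨h1, h2⟩ := hT₀ T hT
  have h3 := hC α hα T h2 Θ hΘ S hreg b hb
  linarith
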